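/- \textbf{Theorem (Wick formula of type B).} Let $\alpha,q\in(-1,1)$, let $H_{\mathbb R}$ be a separable real Hilbert space with complexification $H$ (inner product linear on the right), and let $x\mapsto\bar x$ be a self-adjoint involution of $H$ (a linear map with $\bar{\bar x}=x$ and $\langle\bar x,y\rangle=\langle x,\bar y\rangle$). Let $\Sigma(n)$ be the group of bijections $\sigma$ of $\{\pm1,\dots,\pm n\}$ with $\sigma(-k)=-\sigma(k)$, generated by $\pi_0=(1,-1)$ and $\pi_i=(i,i+1)$, $1\le i\le n-1$, acting on $H^{\otimes n}$ by letting $\pi_0$ replace $x_1$ by $\overline{x_1}$ and $\pi_i$ exchange the factors $i$ and $i+1$; let $l_1(\sigma)$ (resp. $l_2(\sigma)$) be the number of $\pi_0$ (resp. of $\pi_i$ with $i\ge1$) in a minimal length expression of $\sigma$. On the algebraic Fock space $\mathcal F=\bigoplus_{n\ge0}H^{\otimes n}$, with $H^{\otimes0}=\mathbb C\Omega$, put $$\langle f,g\rangle_{\alpha,q}=\sum_{n}\Big\langle f_n,\sum_{\sigma\in\Sigma(n)}\alpha^{l_1(\sigma)}q^{l_2(\sigma)}\sigma\, g_n\Big\rangle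 ,\qquad \langle x_1\otimes\cdots\otimes x_n,y_1\otimes\cdots\otimes y_n\rangle=\prod_i\langle x_i,y_i\rangle ,$$ with $0^0=1$. Let $b^*(x)$ be the operator $x_1\otimes\cdots\otimes x_n\mapsto x_1\otimes\cdots\otimes x_n\otimes x$, $\Omega\mapsto x$. For every $x\in H$ it has exactly one adjoint on $\mathcal F$ with respect to $\langle\cdot,\cdot\rangle_{\alpha,q}$, denoted $b^1(x)=b(x)$. For $\epsilon\in\{1,*\}^n$ let $P_{1,2;\epsilon}(n)$ be the set of the partitions $\pi$ of $\{1,\dots,n\}$ into pairs and singletons such that $\epsilon(a)=*$, $\epsilon(b)=1$ for every pair $\{a<b\}$ of $\pi$ and $\epsilon(c)=*$ for every singleton $\{c\}$ of $\pi$; let $P^B_{1,2;\epsilon}(n)$ be the set of $(\pi,f)$ with $\pi\in P_{1,2;\epsilon}(n)$ and $f$ a colouring of the blocks of $\pi$ by $\pm1$ that is $1$ on singletons. Say that a block $W$ covers a block $V$ if there are $i,j\in W$ with $i<k<j$ for all $k\in V$, and that a singleton $\{i\}$ is to the left of $V$ if $i<j$ for all $j\in V$. Let $\mathrm{Cr}(\pi)$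 be the number of unordered pairs of blocks $\{V,W\}$ with $i<k<j<l$ for some $i,j\in V$, $k,l\in W$; $\mathrm{InS}(\pi)$ the number of $(V,W)$ with $V$ a singleton covered by $W$; $\mathrm{NB}(\pi,f)$ the number of blocks of colour $-1$; $\mathrm{InNB}(\pi,f)$ the number of $(V,W)$ with $V$ a pair of colour $-1$ covered by $W$; $\mathrm{SLNB}(\pi,f)$ the number of $(V,W)$ with $V$ a singleton to the left of a pair $W$ of colour $-1$; $\mathrm{Cov}(V)$ the number of blocks covering $V$; $\mathrm{SL}(V)$ the number of singletons to the left of $V$. For a pair we write $\{i,j\}$ with $i>j$. Then for all $n\ge0$, all $x_1,\dots,x_n\in H_{\mathbb R}$ and all $\epsilon\in\{1,*\}^n$, $$b^{\epsilon(n)}(x_n)\cdots b^{\epsilon(1)}(x_1)\Omega=\sum_{(\pi,f)\in P^B_{1,2;\epsilon}(n)}\alpha^{\mathrm{NB}(\pi,f)}q^{\mathrm{Cr}(\pi)+\mathrm{InS}(\pi)+2\mathrm{InNB}(\pi,f)+2\mathrm{SLNB}(\pi,f)}\prod_{f(\{i,j\})=1}\langle x_i,x_j\rangle\prod_{f(\{i,j\})=-1}\langle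 x_i,\overline{x_j}\rangle\ \bigotimes_{\{i\}\in\pi}x_i,$$ where the products are over the pairs of $\pi$ of the indicated colour, and the tensor product is over the singletons in increasing order (it is $\Omega$ if there are none). Moreover, $$b^{\epsilon(n)}(x_n)\cdots b^{\epsilon(1)}(x_1)\Omega=\sum_{\pi\in P_{1,2;\epsilon}(n)}q^{\mathrm{Cr}(\pi)+\mathrm{InS}(\pi)}\prod_{\{i,j\}\in\pi,\ i>j}\Big(\langle x_i,x_j\rangle+\alpha q^{2\mathrm{Cov}(\{i,j\})+2\mathrm{SL}(\{i,j\})}\langle x_i,\overline{x_j}\rangle\Big)\bigotimes_{\{i\}\in\pi}x_i .$$ Here $\langle x_i,x_j\rangle=\langle x_j,x_i\rangle$ always, and if the involution maps $H_{\mathbb R}$ into itself, then also $\langle x_i,\overline{x_j}\rangle=\langle x_j,\overline{x_i}\rangle$ for all $i,j$, so that the order of the two elements of a pair is immaterial. -/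

import Mathlib

open scoped TensorProduct DirectSum ComplexConjugate InnerProductSpace

noncomputable section

namespace TypeBFock

/-! ### The complexification of a real inner product space -/

/-- The complexification of a real vector space `V`: the pair `(a, b)` stands for `a + i b`. -/
def Complexification (V : Type*) : Type _ := V × V

namespace Complexification

set_option linter.unusedSectionVars false

variable {V : Type*} [NormedAddCommGroup V] [InnerProductSpace ℝ V]

instance instAddCommGroup : AddCommGroup (Complexification V) :=
  inferInstanceAs (AddCommGroup (V × V))

/-- The real part. -/
def re (z : Complexification V) : V := z.1

/-- The imaginary part. -/
def im (z : Complexification V) : V := z.2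

/-- The element `a + i b`. -/
def mk (a b : V) : Complexification V := (a, b)

/-- The canonical inclusion of the real space in its complexification. -/
def ofReal (a : V) : Complexification V := mk a 0

@[ext] theorem ext {z w : Complexification V} (h₁ : z.re = w.re) (h₂ : z.im = w.im) : z = w :=
  Prod.ext h₁ h₂

@[simp] theorem re_mk (a b : V) : (mk a b).re = a := rfl
@[simp] theorem im_mk (a b : V) : (mk a b).im = b := rfl
@[simp] theorem re_zero : (0 : Complexification V).re = 0 := rfl
@[simp] theorem im_zero : (0 : Complexification V).im = 0 := rfl
@[simp] theorem re_add (z w : Complexification V) : (z + w).re = z.re + w.re := rfl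
@[simp] theorem im_add (z w : Complexification V) : (z + w).im = z.im + w.im := rfl

/-- `(r + i s) • (a + i b) = (r a - s b) + i (r b + s a)`. -/
instance instSMul : SMul ℂ (Complexification V) where
  smul c z := mk (c.re • z.re - c.im • z.im) (c.re • z.im + c.im • z.re)

@[simp] theorem re_smul (c : ℂ) (z : Complexification V) :
    (c • z).re = c.re • z.re - c.im • z.im := rfl
@[simp] theorem im_smul (c : ℂ) (z : Complexification V) :
    (c • z).im = c.re • z.im + c.im • z.re := rfl

instance instModule : Module ℂ (Complexification V) where
  one_smul z := by ext <;> simp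
  mul_smul c d z := by
    ext
    · simp only [re_smul, im_smul, Complex.mul_re, Complex.mul_im]; module
    · simp only [re_smul, im_smul, Complex.mul_re, Complex.mul_im]; module
  smul_zero c := by ext <;> simp
  smul_add c z w := by
    ext
    · simp only [re_smul, re_add, im_add]; module
    · simp only [im_smul, re_add, im_add]; module
  add_smul c d z := by
    ext
    · simp only [re_smul, re_add, Complex.add_re, Complex.add_im]; module
    · simp only [im_smul, im_add, Complex.add_re, Complex.add_im]; module
  zero_smul z := by ext <;> simp

/-- The sesquilinear extension of the real inner product, linear on the right and antilinear on
the left. -/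
@[reducible] def innerCore : InnerProductSpace.Core ℂ (Complexification V) where
  inner z w := ⟨⟪z.re, w.re⟫_ℝ + ⟪z.im, w.im⟫_ℝ, ⟪z.re, w.im⟫_ℝ - ⟪z.im, w.re⟫_ℝ⟩
  conj_inner_symm z w := by
    apply Complex.ext
    · simp [real_inner_comm]
    · simp [real_inner_comm]
  re_inner_nonneg z := by
    have h₁ : 0 ≤ ⟪z.re, z.re⟫_ℝ := real_inner_self_nonneg
    have h₂ : 0 ≤ ⟪z.im, z.im⟫_ℝ := real_inner_self_nonneg
    exact add_nonneg h₁ h₂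
  add_left x y z := by
    apply Complex.ext
    · simp only [re_add, im_add, inner_add_left, Complex.add_re]; ring
    · simp only [re_add, im_add, inner_add_left, Complex.add_im]; ring
  smul_left x y r := by
    apply Complex.ext
    · simp only [re_smul, im_smul, inner_add_left, inner_sub_left, real_inner_smul_left,
        Complex.mul_re, Complex.conj_re, Complex.conj_im]
      ring
    · simp only [re_smul, im_smul, inner_add_left, inner_sub_left, real_inner_smul_left,
        Complex.mul_im, Complex.conj_re, Complex.conj_im]
      ring
  definite z hz := by
    have h : ⟪z.re, z.re⟫_ℝ + ⟪z.im, z.im⟫_ℝ = 0 := congrArg Complex.re hz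
    have h₁ : 0 ≤ ⟪z.re, z.re⟫_ℝ := real_inner_self_nonneg
    have h₂ : 0 ≤ ⟪z.im, z.im⟫_ℝ := real_inner_self_nonneg
    ext
    · exact inner_self_eq_zero.mp (by linarith : ⟪z.re, z.re⟫_ℝ = 0)
    · exact inner_self_eq_zero.mp (by linarith : ⟪z.im, z.im⟫_ℝ = 0)

instance instNormedAddCommGroup : NormedAddCommGroup (Complexification V) :=
  innerCore.toNormedAddCommGroup

instance instInnerProductSpace : InnerProductSpace ℂ (Complexification V) :=
  InnerProductSpace.ofCore innerCore.toCore

theorem inner_def (z w : Complexification V) :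
    ⟪z, w⟫_ℂ =
      ⟨⟪z.re, w.re⟫_ℝ + ⟪z.im, w.im⟫_ℝ, ⟪z.re, w.im⟫_ℝ - ⟪z.im, w.re⟫_ℝ⟩ := rfl

end Complexification

/-! ### The Coxeter group of type B -/

/-- The Coxeter group of type B: the bijections `σ` of `{±1, …, ±n}` with `σ (-k) = -σ k`.
The point `±(k + 1)` is encoded as the pair `(k, ±1)` with `k : Fin n`. -/
def hyperoctahedral (n : ℕ) : Subgroup (Equiv.Perm (Fin n × ℤˣ)) where
  carrier := {σ | ∀ k s, σ (k, -s) = ((σ (k, s)).1, -(σ (k, s)).2)}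
  mul_mem' {σ τ} hσ hτ k s := by
    change ∀ k s, _ at hσ hτ
    rw [Equiv.Perm.mul_apply, hτ, hσ, Equiv.Perm.mul_apply]
  one_mem' k s := rfl
  inv_mem' {σ} hσ k s := by
    change ∀ k s, _ at hσ
    rw [Equiv.Perm.inv_eq_iff_eq, hσ]
    simp

instance (n : ℕ) : Fintype (hyperoctahedral n) := Fintype.ofFinite _

/-- The Coxeter generators `π₀ = (1, -1)` and `π_i = (i, i + 1)`, `1 ≤ i ≤ n - 1`. -/
def generator (n : ℕ) (i : Fin n) : Equiv.Perm (Fin n × ℤˣ) :=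
  if i.val = 0 then Equiv.swap (i, 1) (i, -1)
  else Equiv.prodCongr
    (Equiv.swap ⟨i.val - 1, lt_of_le_of_lt (Nat.sub_le _ _) i.isLt⟩ i) (Equiv.refl ℤˣ)

/-- `w` is an irreducible (minimal length) expression of `σ` as a product of generators. -/
def IsReducedWord {n : ℕ} (w : List (Fin n)) (σ : hyperoctahedral n) : Prop :=
  (w.map (generator n)).prod = σ.1 ∧
    ∀ w' : List (Fin n), (w'.map (generator n)).prod = σ.1 → w.length ≤ w'.length

/-- The number of `π₀` appearing in an irreducible expression of `σ`
(all irreducible expressions have the same number). -/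
def length₁ {n : ℕ} (σ : hyperoctahedral n) : ℕ :=
  sInf {k | ∃ w, IsReducedWord w σ ∧ k = w.countP (fun i => i.val = 0)}

/-- The number of `π_i`, `1 ≤ i ≤ n - 1`, appearing in an irreducible expression of `σ`
(all irreducible expressions have the same number). -/
def length₂ {n : ℕ} (σ : hyperoctahedral n) : ℕ :=
  sInf {k | ∃ w, IsReducedWord w σ ∧ k = w.countP (fun i => i.val ≠ 0)}

/-- The permutation `k ↦ |σ k|` of the `n` positions. -/
def absPerm {n : ℕ} (σ : hyperoctahedral n) : Equiv.Perm (Fin n) where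
  toFun k := (σ.1 (k, 1)).1
  invFun k := (σ.1⁻¹ (k, 1)).1
  left_inv k := by
    change (σ.1⁻¹ ((σ.1 (k, 1)).1, 1)).1 = k
    rcases Int.units_eq_one_or (σ.1 (k, 1)).2 with hs | hs
    · have : ((σ.1 (k, 1)).1, (1 : ℤˣ)) = σ.1 (k, 1) := Prod.ext rfl hs.symm
      rw [this]; simp
    · have h1 : ((σ.1 (k, 1)).1, (1 : ℤˣ)) = σ.1 (k, -1) := by
        rw [σ.2 k 1, hs]; simp
      rw [h1]; simp
  right_inv k := by
    change (σ.1 ((σ.1⁻¹ (k, 1)).1, 1)).1 = k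
    rcases Int.units_eq_one_or (σ.1⁻¹ (k, 1)).2 with hs | hs
    · have : ((σ.1⁻¹ (k, 1)).1, (1 : ℤˣ)) = σ.1⁻¹ (k, 1) := Prod.ext rfl hs.symm
      rw [this]; simp
    · have h1 : ((σ.1⁻¹ (k, 1)).1, (1 : ℤˣ)) = σ.1⁻¹ (k, -1) := by
        have := (σ⁻¹).2 k 1
        rw [Subgroup.coe_inv] at this
        rw [this, hs]; simp
      rw [h1]; simp

/-! ### Tensor powers -/

section Tensor

variable {H : Type*} [NormedAddCommGroup H] [InnerProductSpace ℂ H]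

/-- The action of the Coxeter group of type B on `H^{⊗ n}` determined by an involution `J` of `H`:
the factor `x_k` moves to position `|σ k|` and becomes `J x_k` when `σ k` is negative. -/
def groupAction (J : H →ₗ[ℂ] H) {n : ℕ} (σ : hyperoctahedral n) :
    (⨂[ℂ]^n H) →ₗ[ℂ] (⨂[ℂ]^n H) :=
  (PiTensorProduct.reindex ℂ (fun _ : Fin n => H) (absPerm σ)).toLinearMap ∘ₗ
    PiTensorProduct.map (fun k : Fin n => if (σ.1 (k, 1)).2 = 1 then LinearMap.id else J)

theorem groupAction_tprod (J : H →ₗ[ℂ] H) {n : ℕ} (σ : hyperoctahedral n) (x : Fin n → H) :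
    groupAction J σ (PiTensorProduct.tprod ℂ x) = PiTensorProduct.tprod ℂ (fun j =>
      (if (σ.1 ((absPerm σ).symm j, 1)).2 = 1 then LinearMap.id else J : H →ₗ[ℂ] H)
        (x ((absPerm σ).symm j))) := by
  simp [groupAction]

/-- The type B symmetrization operator `P^{(n)}_{α,q} = ∑_σ α^{l₁(σ)} q^{l₂(σ)} σ`. -/
def symmetrizer (J : H →ₗ[ℂ] H) (α q : ℝ) (n : ℕ) : (⨂[ℂ]^n H) →ₗ[ℂ] (⨂[ℂ]^n H) :=
  ∑ σ : hyperoctahedral n, ((α : ℂ) ^ length₁ σ * (q : ℂ) ^ length₂ σ) • groupAction J σ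

/-- The linear form `x₁ ⊗ ⋯ ⊗ x_n ↦ ∏ ⟨y_i, x_i⟩`. -/
def prodForm {n : ℕ} (y : Fin n → H) : MultilinearMap ℂ (fun _ : Fin n => H) ℂ :=
  (MultilinearMap.mkPiAlgebra ℂ (Fin n) ℂ).compLinearMap (fun i => innerₛₗ ℂ (y i))

theorem prodForm_apply {n : ℕ} (y v : Fin n → H) : prodForm y v = ∏ i, ⟪y i, v i⟫_ℂ := by
  simp [prodForm]

theorem conj_prodForm {n : ℕ} (y v : Fin n → H) : conj (prodForm y v) = prodForm v y := by
  simp [prodForm_apply, map_prod]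

/-- The antilinear form `x₁ ⊗ ⋯ ⊗ x_n ↦ ∏ ⟨x_i, y_i⟩`, as a multilinear function of `y`. -/
def tensorInnerAux (n : ℕ) :
    MultilinearMap ℂ (fun _ : Fin n => H) ((⨂[ℂ]^n H) →ₗ⋆[ℂ] ℂ) where
  toFun y := (starLinearEquiv ℂ : ℂ ≃ₗ⋆[ℂ] ℂ).toLinearMap.comp (PiTensorProduct.lift (prodForm y))
  map_update_add' y i a b := by
    have h : prodForm (Function.update y i (a + b)) =
        prodForm (Function.update y i a) + prodForm (Function.update y i b) := by
      ext v
      apply (starRingEnd ℂ).injective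
      rw [add_apply, map_add]
      simp only [conj_prodForm]
      exact (prodForm v).map_update_add y i a b
    rw [h, map_add, LinearMap.comp_add]
  map_update_smul' y i c a := by
    have h : prodForm (Function.update y i (c • a)) =
        conj c • prodForm (Function.update y i a) := by
      ext v
      apply (starRingEnd ℂ).injective
      rw [smul_apply, smul_eq_mul, map_mul, Complex.conj_conj]
      simp only [conj_prodForm]
      exact (prodForm v).map_update_smul y i c a
    rw [h, map_smul]
    ext t
    simp

/-- The inner product `⟨x₁ ⊗ ⋯ ⊗ x_n, y₁ ⊗ ⋯ ⊗ y_n⟩₀₀ = ∏ ⟨x_i, y_i⟩` on `H^{⊗ n}`. -/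
def tensorInner (n : ℕ) : (⨂[ℂ]^n H) →ₗ⋆[ℂ] (⨂[ℂ]^n H) →ₗ[ℂ] ℂ :=
  (PiTensorProduct.lift (tensorInnerAux (H := H) n)).flip

theorem tensorInner_tprod (n : ℕ) (x y : Fin n → H) :
    tensorInner n (PiTensorProduct.tprod ℂ x) (PiTensorProduct.tprod ℂ y) =
      ∏ i, ⟪x i, y i⟫_ℂ := by
  simp [tensorInner, tensorInnerAux, prodForm_apply]

end Tensor

/-! ### The Fock space of type B -/

/-- The algebraic full Fock space `⨁ₙ H^{⊗ n}`. -/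
abbrev Fock (H : Type*) [NormedAddCommGroup H] [InnerProductSpace ℂ H] : Type _ :=
  ⨁ n : ℕ, ⨂[ℂ]^n H

section Fock

variable {H : Type*} [NormedAddCommGroup H] [InnerProductSpace ℂ H]

/-- The pure tensor `x₁ ⊗ ⋯ ⊗ x_n` in the Fock space. -/
def pureTensor {n : ℕ} (x : Fin n → H) : Fock H :=
  DirectSum.lof ℂ ℕ (fun n => ⨂[ℂ]^n H) n (PiTensorProduct.tprod ℂ x)

/-- The vacuum vector `Ω`. -/
def vacuum : Fock H := pureTensor (Fin.elim0 : Fin 0 → H)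

/-- The deformed inner product `⟨f, g⟩_{α,q} = ∑ₙ ⟨fₙ, P^{(n)}_{α,q} gₙ⟩₀₀`. -/
def fockInner (J : H →ₗ[ℂ] H) (α q : ℝ) (f g : Fock H) : ℂ :=
  DirectSum.toModule ℂ ℕ ℂ (fun n => tensorInner n (f n) ∘ₗ symmetrizer J α q n) g

/-- The linear map `x₁ ⊗ ⋯ ⊗ x_n ↦ x₁ ⊗ ⋯ ⊗ x_n ⊗ x` on `H^{⊗ n}`. -/
def appendTensor (x : H) (n : ℕ) : (⨂[ℂ]^n H) →ₗ[ℂ] (⨂[ℂ]^(n + 1) H) :=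
  PiTensorProduct.lift ((LinearMap.applyₗ x).compMultilinearMap
    (PiTensorProduct.tprod ℂ (s := fun _ : Fin (n + 1) => H)).curryRight)

/-- The (right) creation operator of type B. -/
def creation (x : H) : Module.End ℂ (Fock H) :=
  DirectSum.toModule ℂ ℕ (Fock H)
    (fun n => DirectSum.lof ℂ ℕ (fun n => ⨂[ℂ]^n H) (n + 1) ∘ₗ appendTensor x n)

theorem creation_pureTensor (x : H) {n : ℕ} (v : Fin n → H) :
    creation x (pureTensor v) = pureTensor (Fin.snoc v x : Fin (n + 1) → H) := by
  simp [creation, pureTensor, appendTensor]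

/-- `T` is an adjoint of the creation operator `b*(x)` for the deformed inner product. -/
def IsCreationAdjoint (J : H →ₗ[ℂ] H) (α q : ℝ) (x : H) (T : Module.End ℂ (Fock H)) : Prop :=
  ∀ f g : Fock H, fockInner J α q (creation x f) g = fockInner J α q f (T g)

open Classical in
/-- The annihilation operator of type B: the adjoint of `creation x` for the deformed inner
product. -/
def annihilation (J : H →ₗ[ℂ] H) (α q : ℝ) (x : H) : Module.End ℂ (Fock H) :=
  if h : ∃ T, IsCreationAdjoint J α q x T then h.choose else 0

/-- The alphabet `{1, ∗}`. -/
inductive Exponent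
  | one
  | star

/-- `b^∗(x)` is the creation operator and `b^1(x)` is the annihilation operator. -/
def fockOp (J : H →ₗ[ℂ] H) (α q : ℝ) : Exponent → H → Module.End ℂ (Fock H)
  | .one, x => annihilation J α q x
  | .star, x => creation x

/-- The operator `b^{ε(n)}(x_n) ⋯ b^{ε(1)}(x_1)`. -/
def fockWord (J : H →ₗ[ℂ] H) (α q : ℝ) {n : ℕ} (ε : Fin n → Exponent) (x : Fin n → H) :
    Module.End ℂ (Fock H) :=
  (List.ofFn fun i => fockOp J α q (ε i) (x i)).reverse.prod

/-- The tensor product `⨂_{i ∈ S} x_i`, in increasing order of the indices; it is `Ω` when `S` is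
empty. -/
def tensorOver {n : ℕ} (x : Fin n → H) (S : Finset (Fin n)) : Fock H :=
  pureTensor (fun k : Fin S.card => x (S.orderEmbOfFin rfl k))

end Fock

/-! ### Set partitions of type B and their statistics -/

/-- The set partitions of `{1, …, n}`. -/
abbrev SetPartition (n : ℕ) : Type := Finpartition (Finset.univ : Finset (Fin n))

/-- The blocks of a set partition. -/
abbrev Block {n : ℕ} (π : SetPartition n) : Type := {V : Finset (Fin n) // V ∈ π.parts}

/-- The set partitions of type B of `{1, …, n}`: a set partition with a `±1` colouring of its
blocks. -/
abbrev SetPartitionB (n : ℕ) : Type := (π : SetPartition n) × (Block π → ℤˣ)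

section Partition

variable {n : ℕ}

/-- The smallest element of a block. -/
def lo {π : SetPartition n} (V : Block π) : Fin n := V.1.min' (π.nonempty_of_mem_parts V.2)

/-- The largest element of a block. -/
def hi {π : SetPartition n} (V : Block π) : Fin n := V.1.max' (π.nonempty_of_mem_parts V.2)

/-- The block is a singleton. -/
def IsSingleton {π : SetPartition n} (V : Block π) : Prop := V.1.card = 1

/-- The block is a pair. -/
def IsPair {π : SetPartition n} (V : Block π) : Prop := V.1.card = 2

/-- All blocks are singletons or pairs; in a pair `{a < b}` one has `ε(a) = ∗` and `ε(b) = 1`, and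
`ε(c) = ∗` for every singleton `{c}`. -/
def IsCompatible (ε : Fin n → Exponent) (π : SetPartition n) : Prop :=
  ∀ V : Block π, (IsPair V ∧ ε (lo V) = .star ∧ ε (hi V) = .one) ∨
    (IsSingleton V ∧ ε (lo V) = .star)

open Classical in
/-- The set `P_{1,2;ε}(n)`. -/
def partitions (ε : Fin n → Exponent) : Finset (SetPartition n) :=
  {π | IsCompatible ε π}

open Classical in
/-- The set `P^B_{1,2;ε}(n)`: singletons have colour `1`. -/
def partitionsB (ε : Fin n → Exponent) : Finset (SetPartitionB n) :=
  {p | IsCompatible ε p.1 ∧ ∀ V : Block p.1, IsSingleton V → p.2 V = 1}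

open Classical in
/-- The pair blocks. -/
def pairs (π : SetPartition n) : Finset (Block π) := {V | IsPair V}

open Classical in
/-- The set of the `i` such that `{i}` is a singleton of the partition. -/
def singletons (π : SetPartition n) : Finset (Fin n) := {i | {i} ∈ π.parts}

/-- `W` covers `V`. -/
def Covers {π : SetPartition n} (W V : Block π) : Prop :=
  ∃ i ∈ W.1, ∃ j ∈ W.1, ∀ k ∈ V.1, i < k ∧ k < j

/-- `V` is to the left of `W`. -/
def LeftOf {π : SetPartition n} (V W : Block π) : Prop :=
  ∀ i ∈ V.1, ∀ j ∈ W.1, i < j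

open Classical in
/-- `Cr`: the number of unordered pairs `{V, W}` of blocks that cross. -/
def crossings (π : SetPartition n) : ℕ :=
  Finset.card {S : Finset (Block π) | ∃ V W : Block π, V ≠ W ∧ S = {V, W} ∧
    ∃ i ∈ V.1, ∃ j ∈ V.1, ∃ k ∈ W.1, ∃ l ∈ W.1, i < k ∧ k < j ∧ j < l}

open Classical in
/-- `InS`: the number of pairs of a singleton and a covering block. -/
def innerSingletons (π : SetPartition n) : ℕ :=
  Finset.card {P : Block π × Block π | IsSingleton P.1 ∧ Covers P.2 P.1}

open Classical in
/-- `NB`: the number of negative blocks. -/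
def negativeBlocks (p : SetPartitionB n) : ℕ :=
  Finset.card {V : Block p.1 | p.2 V = -1}

open Classical in
/-- `InNB`: the number of pairs of a negative pair block and a covering block. -/
def innerNegativeBlocks (p : SetPartitionB n) : ℕ :=
  Finset.card {P : Block p.1 × Block p.1 | IsPair P.1 ∧ p.2 P.1 = -1 ∧ Covers P.2 P.1}

open Classical in
/-- `SLNB`: the number of pairs of a negative pair block and a singleton to the left of it. -/
def singletonsLeftNegative (p : SetPartitionB n) : ℕ :=
  Finset.card {P : Block p.1 × Block p.1 |
    IsPair P.2 ∧ p.2 P.2 = -1 ∧ IsSingleton P.1 ∧ LeftOf P.1 P.2}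

open Classical in
/-- `Cov(V)`: the number of blocks that cover `V`. -/
def coverCount {π : SetPartition n} (V : Block π) : ℕ :=
  Finset.card {W : Block π | Covers W V}

open Classical in
/-- `SL(V)`: the number of singletons to the left of `V`. -/
def singletonsLeft {π : SetPartition n} (V : Block π) : ℕ :=
  Finset.card {W : Block π | IsSingleton W ∧ LeftOf W V}

end Partition

end TypeBFock

end

open scoped TensorProduct DirectSum ComplexConjugate InnerProductSpace

noncomputable section

namespace TypeBFock

/-! ### Signed permutations and their inversions -/

section SignedPerm

variable {n : ℕ}

/-! The two lengths of a signed permutation are inversion numbers. `l₁` is the number of negative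
signs; `l₂` is the sum over the positions `i < j` of a term which is 1 if `|σ j| < |σ i|`, and
otherwise 2 or 0 according as `σ j` is negative or positive. Each generator can raise only the
number of its own kind, by at most one, and a signed permutation that no generator lowers is the
identity. So every reduced word has exactly these letter counts (`length₁_eq`, `length₂_eq`).

Uniqueness of the adjoint reduces to injectivity of the symmetrizer. The lengths of `σ τ⁻¹` count
the reflecting hyperplanes of either kind that separate `σ` and `τ` (`lengths_mul_inv`). Hence the
kernel `α^{l₁(σ τ⁻¹)} q^{l₂(σ τ⁻¹)}` is a product over hyperplanes of factors equal to 1 or to a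
constant in `(-1, 1)`. Such a factor is a positive combination of 1 and a product of two signs,
which makes the kernel invertible (`isUnit_of_prod_kernel`, `isUnit_lengthKernel`). Applied to the
family `τ⁻¹ t`, it shows that a tensor `t` killed by the symmetrizer is zero.

Existence is explicit. Sorting the signed permutations of `n + 1` points by the position `k`,
counted from 0, that goes to the last place up to sign, one gets an adjoint that removes the `k`-th
factor `v_k` with coefficient `q^(n-k) ⟨x, v_k⟩ + α q^(n+k) ⟨x, J v_k⟩` (`pairInv_insert`,
`isCreationAdjoint_annihOp`).

The Wick formula is then an induction on the word. A creation adds an open point on the right; an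
annihilation at `n` closes some open point `k` to a pair `(k, n)`. Its factor `q` to the number of
open points right of `k` is the growth of `Cr + InS`; the number of open points left of `k` is `SL`
of the new pair, which nothing covers. An old pair right of `k` loses a singleton on its left and
gains a covering pair, so `Cov + SL` does not change (`diagramWeight_insert`). The coloured formula
is the product over the pairs multiplied out (`sum_colourings`). -/

/-- The sign of `σ k` for a positive `k`. -/
def signAt (σ : hyperoctahedral n) (k : Fin n) : ℤˣ := (σ.1 (k, 1)).2

theorem hyperoctahedral_apply (σ : hyperoctahedral n) (k : Fin n) (t : ℤˣ) :
    σ.1 (k, t) = (absPerm σ k, signAt σ k * t) := by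
  rcases Int.units_eq_one_or t with rfl | rfl
  · rw [mul_one]; rfl
  · rw [σ.2 k 1]; simp [absPerm, signAt]

theorem hyperoctahedral_ext {σ τ : hyperoctahedral n} (h₁ : absPerm σ = absPerm τ)
    (h₂ : signAt σ = signAt τ) : σ = τ := by
  apply Subtype.ext
  ext1 ⟨k, t⟩
  rw [hyperoctahedral_apply, hyperoctahedral_apply, h₁, h₂]

theorem absPerm_mul (σ τ : hyperoctahedral n) : absPerm (σ * τ) = absPerm σ * absPerm τ := by
  ext1 k
  change (σ.1 (τ.1 (k, 1))).1 = _
  rw [hyperoctahedral_apply τ, hyperoctahedral_apply σ]; rfl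

theorem signAt_mul (σ τ : hyperoctahedral n) (k : Fin n) :
    signAt (σ * τ) k = signAt σ (absPerm τ k) * signAt τ k := by
  change (σ.1 (τ.1 (k, 1))).2 = _
  rw [hyperoctahedral_apply τ, hyperoctahedral_apply σ]; simp

@[simp] theorem absPerm_one : absPerm (1 : hyperoctahedral n) = 1 := by
  ext1 k; rfl

@[simp] theorem signAt_one (k : Fin n) : signAt (1 : hyperoctahedral n) k = 1 := rfl

/-- The signed permutation with given absolute values and signs. -/
def ofPermSign (p : Equiv.Perm (Fin n)) (s : Fin n → ℤˣ) : hyperoctahedral n :=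
  ⟨{ toFun := fun a => (p a.1, s a.1 * a.2)
     invFun := fun a => (p.symm a.1, s (p.symm a.1) * a.2)
     left_inv := fun a => by
      ext1
      · simp
      · simp [← mul_assoc, Int.units_mul_self]
     right_inv := fun a => by
      ext1
      · simp
      · simp [← mul_assoc, Int.units_mul_self] },
   fun k t => by simp⟩

@[simp] theorem absPerm_ofPermSign (p : Equiv.Perm (Fin n)) (s : Fin n → ℤˣ) :
    absPerm (ofPermSign p s) = p := by
  ext1 k; rfl

@[simp] theorem signAt_ofPermSign (p : Equiv.Perm (Fin n)) (s : Fin n → ℤˣ) :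
    signAt (ofPermSign p s) = s := by
  ext1 k; simp [signAt, ofPermSign]

/-- Signed permutations are pairs of a permutation and a sign function. -/
def signedPermEquiv (n : ℕ) : hyperoctahedral n ≃ Equiv.Perm (Fin n) × (Fin n → ℤˣ) where
  toFun σ := (absPerm σ, signAt σ)
  invFun a := ofPermSign a.1 a.2
  left_inv σ := hyperoctahedral_ext (by simp) (by simp)
  right_inv a := by simp

/-- The number of negative signs. -/
def negCount (s : Fin n → ℤˣ) : ℕ := Finset.card {k | s k = -1}

/-- The contribution of two positions to the number of inversions of a signed permutation. -/
def pairTerm (p : Equiv.Perm (Fin n)) (s : Fin n → ℤˣ) (a : Fin n × Fin n) : ℕ :=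
  if a.1 < a.2 then (if p a.2 < p a.1 then 1 else if s a.2 = -1 then 2 else 0) else 0

/-- The number of inversions of a signed permutation that are not sign changes. -/
def pairInv (p : Equiv.Perm (Fin n)) (s : Fin n → ℤˣ) : ℕ := ∑ a, pairTerm p s a

theorem swap_adjacent_lt_iff {a b : Fin n} (hab : a.val + 1 = b.val) (i j : Fin n)
    (h₁ : ¬(i = a ∧ j = b)) (h₂ : ¬(i = b ∧ j = a)) :
    Equiv.swap a b i < Equiv.swap a b j ↔ i < j := by
  have hne : a ≠ b := by rintro rfl; omega
  simp only [Equiv.swap_apply_def]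
  simp only [Fin.ext_iff, Fin.lt_def] at *
  split_ifs <;> omega

/-- An adjacent swap of values alters the relative order of the values at just one pair of
positions, those where `a` and `b` are taken. The term of this pair passes from 0 or 2 to 1; the 2
stands on the left to avoid subtraction. -/
theorem pairInv_swap_mul {a b : Fin n} (hab : a.val + 1 = b.val) (p : Equiv.Perm (Fin n))
    (s : Fin n → ℤˣ) (hlt : p.symm a < p.symm b) :
    pairInv (Equiv.swap a b * p) s + (if s (p.symm b) = -1 then 2 else 0) = pairInv p s + 1 := by
  have hne : a < b := by rw [Fin.lt_def]; omega
  have key : ∀ c ∈ (Finset.univ : Finset (Fin n × Fin n)).erase (p.symm a, p.symm b),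
      pairTerm (Equiv.swap a b * p) s c = pairTerm p s c := by
    rintro ⟨i, j⟩ hc
    have hc' : ¬ (i = p.symm a ∧ j = p.symm b) := by simpa using hc
    unfold pairTerm
    split_ifs with hij <;> try rfl
    all_goals
      have := swap_adjacent_lt_iff hab (p j) (p i)
        (by rintro ⟨h, h'⟩; rw [← h, ← h'] at hlt; simp at hlt; exact absurd hij (not_lt.2 hlt.le))
        (by rintro ⟨h, h'⟩; exact hc' ⟨by simp [← h'], by simp [← h]⟩)
      simp only [Equiv.Perm.mul_apply] at *
      tauto
  unfold pairInv
  rw [← Finset.add_sum_erase _ _ (Finset.mem_univ (p.symm a, p.symm b)),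
    ← Finset.add_sum_erase _ (pairTerm p s) (Finset.mem_univ (p.symm a, p.symm b)),
    Finset.sum_congr rfl key]
  have h1 : pairTerm (Equiv.swap a b * p) s (p.symm a, p.symm b) = 1 := by
    simp [pairTerm, hlt, hne]
  have h2 : pairTerm p s (p.symm a, p.symm b) = if s (p.symm b) = -1 then 2 else 0 := by
    simp [pairTerm, hlt, hne.le]
  rw [h1, h2]; ring

theorem pairInv_swap_mul' {a b : Fin n} (hab : a.val + 1 = b.val) (p : Equiv.Perm (Fin n))
    (s : Fin n → ℤˣ) (hlt : p.symm b < p.symm a) :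
    pairInv (Equiv.swap a b * p) s + 1 = pairInv p s + (if s (p.symm a) = -1 then 2 else 0) := by
  have e : ∀ c, (Equiv.swap a b * p).symm c = p.symm (Equiv.swap a b c) := fun c => rfl
  -- After the swap the two positions are in the order that `pairInv_swap_mul` requires, and
  -- swapping twice gives back `p`.
  have := pairInv_swap_mul hab (Equiv.swap a b * p) s (by simpa [e] using hlt)
  rw [e, Equiv.swap_apply_right, ← mul_assoc, Equiv.swap_mul_self, one_mul] at this
  exact this.symm

/-- The generators as signed permutations. -/
def gen (i : Fin n) : hyperoctahedral n :=
  if i.val = 0 then ofPermSign 1 (fun k => if k = i then -1 else 1)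
  else ofPermSign (Equiv.swap ⟨i.val - 1, lt_of_le_of_lt (Nat.sub_le _ _) i.isLt⟩ i) 1

theorem coe_gen (i : Fin n) : (gen i).1 = generator n i := by
  ext1 ⟨k, t⟩
  rw [hyperoctahedral_apply]
  unfold gen generator
  split_ifs with h
  · rw [absPerm_ofPermSign, signAt_ofPermSign]
    by_cases hk : k = i
    · subst hk
      rcases Int.units_eq_one_or t with rfl | rfl <;> simp
    · rw [Equiv.swap_apply_of_ne_of_ne] <;> simp [hk]
  · simp

theorem prod_gen (w : List (Fin n)) : ((w.map gen).prod).1 = (w.map (generator n)).prod := by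
  induction w with
  | nil => rfl
  | cons i w ih => simp [← ih, coe_gen]

theorem prod_generator_eq_iff (w : List (Fin n)) (σ : hyperoctahedral n) :
    (w.map (generator n)).prod = σ.1 ↔ (w.map gen).prod = σ := by
  rw [← prod_gen, Subtype.ext_iff]

theorem gen_zero_mul {i : Fin n} (hi : i.val = 0) (σ : hyperoctahedral n) :
    absPerm (gen i * σ) = absPerm σ ∧
      signAt (gen i * σ) = Function.update (signAt σ) ((absPerm σ).symm i)
        (-signAt σ ((absPerm σ).symm i)) := by
  constructor
  · simp [absPerm_mul, gen, hi]
  · ext1 k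
    rw [signAt_mul]
    simp only [gen, hi, if_true, signAt_ofPermSign]
    by_cases hk : k = (absPerm σ).symm i
    · subst hk; simp
    · rw [Function.update_of_ne hk, if_neg, one_mul]
      rintro rfl; simp at hk

theorem gen_succ_mul {a b : Fin n} (hab : a.val + 1 = b.val) (σ : hyperoctahedral n) :
    absPerm (gen b * σ) = Equiv.swap a b * absPerm σ ∧ signAt (gen b * σ) = signAt σ := by
  have h0 : b.val ≠ 0 := by omega
  have ha : (⟨b.val - 1, lt_of_le_of_lt (Nat.sub_le _ _) b.isLt⟩ : Fin n) = a := by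
    ext; simp; omega
  constructor
  · simp [absPerm_mul, gen, h0, ha]
  · ext1 k
    simp [signAt_mul, gen, h0]

theorem negCount_update_neg (s : Fin n → ℤˣ) (k : Fin n) :
    (s k = -1 → negCount (Function.update s k (-s k)) + 1 = negCount s) ∧
      (s k = 1 → negCount (Function.update s k (-s k)) = negCount s + 1) := by
  have key : ∀ s : Fin n → ℤˣ, s k = -1 → negCount (Function.update s k 1) + 1 = negCount s := by
    intro s h
    unfold negCount
    have : (Finset.univ.filter fun j => Function.update s k 1 j = -1) =
        (Finset.univ.filter fun j => s j = -1).erase k := by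
      ext j
      by_cases hj : j = k
      · subst hj; simp
      · simp [hj]
    rw [this, Finset.card_erase_add_one (by simpa using h)]
  constructor
  · intro h; rw [h, neg_neg]; exact key s h
  · intro h
    have := key (Function.update s k (-1)) (by simp)
    rw [Function.update_idem, ← h, Function.update_eq_self, h] at this
    rw [h, this]

/-- The sign at a position matters only for earlier positions with a smaller value, and the position
of the smallest value has none. -/
theorem pairInv_update_zero (p : Equiv.Perm (Fin n)) (s : Fin n → ℤˣ) {i : Fin n}
    (hi : i.val = 0) (c : ℤˣ) : pairInv p (Function.update s (p.symm i) c) = pairInv p s := by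
  unfold pairInv
  refine Finset.sum_congr rfl fun a _ => ?_
  unfold pairTerm
  split_ifs with h1 h2 h3 h4 h5 <;> try rfl
  all_goals
    by_cases ha : a.2 = p.symm i
    · exfalso
      apply h2
      rw [ha, Equiv.apply_symm_apply]
      have : p a.1 ≠ i := by
        rintro h; rw [← h, Equiv.symm_apply_apply] at ha; rw [ha] at h1; exact lt_irrefl _ h1
      rw [Fin.lt_def, hi]
      exact Nat.pos_of_ne_zero fun h => this (Fin.ext (by rw [h, hi]))
    · rw [Function.update_of_ne ha] at *
      tauto

/-- The effect of the left multiplication by a generator on the numbers of inversions. -/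
theorem inversions_gen_mul_le (i : Fin n) (σ : hyperoctahedral n) :
    negCount (signAt (gen i * σ)) ≤ negCount (signAt σ) + (if i.val = 0 then 1 else 0) ∧
      pairInv (absPerm (gen i * σ)) (signAt (gen i * σ)) ≤
        pairInv (absPerm σ) (signAt σ) + (if i.val ≠ 0 then 1 else 0) := by
  by_cases hi : i.val = 0
  · obtain ⟨h1, h2⟩ := gen_zero_mul hi σ
    rw [h1, h2, pairInv_update_zero _ _ hi]
    have := negCount_update_neg (signAt σ) ((absPerm σ).symm i)
    refine ⟨?_, by simp⟩
    rw [if_pos hi]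
    rcases Int.units_eq_one_or (signAt σ ((absPerm σ).symm i)) with h | h
    · exact (this.2 h).le
    · have := this.1 h; omega
  · obtain ⟨a, hab⟩ : ∃ a : Fin n, a.val + 1 = i.val := ⟨⟨i.val - 1, by omega⟩, by simp; omega⟩
    obtain ⟨h1, h2⟩ := gen_succ_mul hab σ
    rw [h1, h2]
    refine ⟨by simp, ?_⟩
    rw [if_pos hi]
    have hne : (absPerm σ).symm a ≠ (absPerm σ).symm i := by
      intro h; have := (absPerm σ).symm.injective h; subst this; omega
    rcases lt_or_gt_of_ne hne with h | h
    · have := pairInv_swap_mul hab (absPerm σ) (signAt σ) h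
      omega
    · have := pairInv_swap_mul' hab (absPerm σ) (signAt σ) h
      split_ifs at this <;> omega

/-- The total number of inversions. -/
def inversions (σ : hyperoctahedral n) : ℕ :=
  negCount (signAt σ) + pairInv (absPerm σ) (signAt σ)

theorem gen_mul_self (i : Fin n) : gen i * gen i = 1 := by
  apply Subtype.ext
  rw [Subgroup.coe_mul, coe_gen]
  unfold generator
  split_ifs
  · simp
  · ext1 ⟨k, t⟩; simp

/-- Induction on the values. At the value 0 a negative sign would be removed by `π₀`. Once the value
`m` has sign 1, exchanging `m` and `m + 1` would lower the count if they were inverted (1 becomes 0)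
or if `m + 1` had sign -1 (2 becomes 1). What is left has positive signs and an increasing inverse.
-/
theorem eq_one_of_forall_inversions_le (σ : hyperoctahedral n)
    (h : ∀ i, inversions σ ≤ inversions (gen i * σ)) : σ = 1 := by
  have hsign : ∀ m (hm : m < n), signAt σ ((absPerm σ).symm ⟨m, hm⟩) = 1 ∧
      ∀ hm' : m - 1 < n, (absPerm σ).symm ⟨m - 1, hm'⟩ ≤ (absPerm σ).symm ⟨m, hm⟩ := by
    intro m
    induction m with
    | zero =>
      intro hm
      -- Here `0 - 1 = 0`, so the second claim compares a position with itself.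
      refine ⟨?_, fun _ => le_rfl⟩
      refine (Int.units_eq_one_or _).resolve_right fun hneg => ?_
      obtain ⟨h1, h2⟩ := gen_zero_mul (i := ⟨0, hm⟩) rfl σ
      have h3 := (negCount_update_neg (signAt σ) ((absPerm σ).symm ⟨0, hm⟩)).1 hneg
      have h4 := h ⟨0, hm⟩
      unfold inversions at h4
      rw [h1, h2, pairInv_update_zero _ _ rfl] at h4
      omega
    | succ m ih =>
      intro hm
      obtain ⟨hs, -⟩ := ih (by omega)
      have hab : (⟨m, by omega⟩ : Fin n).val + 1 = (⟨m + 1, hm⟩ : Fin n).val := rfl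
      obtain ⟨h1, h2⟩ := gen_succ_mul hab σ
      have h4 := h ⟨m + 1, hm⟩
      unfold inversions at h4
      rw [h1, h2] at h4
      have hne : (absPerm σ).symm ⟨m, by omega⟩ ≠ (absPerm σ).symm ⟨m + 1, hm⟩ := by
        intro h; have := (absPerm σ).symm.injective h; simp at this
      rcases lt_or_gt_of_ne hne with hlt | hlt
      · refine ⟨?_, fun _ => hlt.le⟩
        refine (Int.units_eq_one_or _).resolve_right fun hneg => ?_
        have := pairInv_swap_mul hab (absPerm σ) (signAt σ) hlt
        rw [if_pos hneg] at this
        omega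
      · exfalso
        have := pairInv_swap_mul' hab (absPerm σ) (signAt σ) hlt
        rw [if_neg (by rw [hs]; decide)] at this
        omega
  have hmono : StrictMono (absPerm σ).symm := by
    apply Monotone.strictMono_of_injective _ (absPerm σ).symm.injective
    cases n with
    | zero => exact fun a => a.elim0
    | succ n =>
      rw [Fin.monotone_iff_le_succ]
      intro i
      exact (hsign (i.val + 1) (by omega)).2 (by simp)
  have hp : absPerm σ = 1 := by
    have : (absPerm σ).symm = 1 := by
      ext1 k
      have := Subsingleton.elim ((hmono.orderIsoOfSurjective _ (absPerm σ).symm.surjective))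
        (OrderIso.refl (Fin n))
      exact congrArg (fun e : Fin n ≃o Fin n => e k) this
    rw [← Equiv.symm_symm (absPerm σ), this]; rfl
  refine hyperoctahedral_ext (by simpa using hp) ?_
  ext1 k
  have := (hsign (absPerm σ k) (absPerm σ k).isLt).1
  simpa using this

/-- As long as some generator lowers the number of inversions, it is split off as the first letter.
An upper bound for the length is enough, because `inversions_le_countP` bounds all words from below.
-/
theorem exists_word_length_eq (σ : hyperoctahedral n) :
    ∃ w : List (Fin n), (w.map gen).prod = σ ∧ w.length ≤ inversions σ := by
  induction hN : inversions σ using Nat.strong_induction_on generalizing σ with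
  | _ N ih =>
    by_cases h : ∀ i, inversions σ ≤ inversions (gen i * σ)
    · exact ⟨[], by simp [eq_one_of_forall_inversions_le σ h], by simp⟩
    · push Not at h
      obtain ⟨i, hi⟩ := h
      obtain ⟨w, hw, hl⟩ := ih _ (hN ▸ hi) (gen i * σ) rfl
      refine ⟨i :: w, ?_, by simp; omega⟩
      rw [List.map_cons, List.prod_cons, hw, ← mul_assoc, gen_mul_self, one_mul]

theorem inversions_le_countP (w : List (Fin n)) :
    negCount (signAt (w.map gen).prod) ≤ w.countP (fun i => i.val = 0) ∧
      pairInv (absPerm (w.map gen).prod) (signAt (w.map gen).prod) ≤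
        w.countP (fun i => i.val ≠ 0) := by
  induction w with
  | nil =>
    constructor
    · simp [negCount]
    · simp only [List.map_nil, List.prod_nil, List.countP_nil, Nat.le_zero, pairInv,
        Finset.sum_eq_zero_iff]
      intro a _
      unfold pairTerm
      split_ifs with h1 h2 h3
      · exact absurd h1 (not_lt.2 (le_of_lt (by simpa using h2)))
      · exact absurd h3 (by simp)
      · rfl
      · rfl
  | cons i w ih =>
    obtain ⟨h1, h2⟩ := inversions_gen_mul_le i (w.map gen).prod
    rw [List.map_cons, List.prod_cons, List.countP_cons, List.countP_cons]
    simp only [decide_eq_true_eq]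
    exact ⟨h1.trans (by omega), h2.trans (by omega)⟩

/-- The two lower bounds of `inversions_le_countP` add up to `inversions σ`, which is also an upper
bound for the length of a reduced word. Both are therefore equalities, and the letter counts do not
depend on the word. -/
theorem countP_of_isReducedWord {w : List (Fin n)} {σ : hyperoctahedral n}
    (hw : IsReducedWord w σ) :
    w.countP (fun i => i.val = 0) = negCount (signAt σ) ∧
      w.countP (fun i => i.val ≠ 0) = pairInv (absPerm σ) (signAt σ) := by
  obtain ⟨h1, h2⟩ := hw
  obtain ⟨w', hw', hl⟩ := exists_word_length_eq σ
  have h3 := h2 w' ((prod_generator_eq_iff _ _).2 hw')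
  rw [prod_generator_eq_iff] at h1
  obtain ⟨h4, h5⟩ := inversions_le_countP w
  rw [h1] at h4 h5
  have h6 := w.length_eq_countP_add_countP (fun i => decide (i.val = 0))
  have h7 : w.countP (fun i => decide ¬ (decide (i.val = 0) = true)) =
      w.countP (fun i => decide (i.val ≠ 0)) := by
    simp
  unfold inversions at hl
  omega

theorem exists_isReducedWord (σ : hyperoctahedral n) : ∃ w, IsReducedWord w σ := by
  obtain ⟨w, hw, hl⟩ := exists_word_length_eq σ
  refine ⟨w, (prod_generator_eq_iff _ _).2 hw, fun w' hw' => ?_⟩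
  rw [prod_generator_eq_iff] at hw'
  obtain ⟨h4, h5⟩ := inversions_le_countP w'
  rw [hw'] at h4 h5
  have h6 := w'.length_eq_countP_add_countP (fun i => decide (i.val = 0))
  have h7 : w'.countP (fun i => decide ¬ (decide (i.val = 0) = true)) =
      w'.countP (fun i => decide (i.val ≠ 0)) := by
    simp
  unfold inversions at hl
  omega

theorem length₁_eq (σ : hyperoctahedral n) : length₁ σ = negCount (signAt σ) := by
  obtain ⟨w₀, h₀⟩ := exists_isReducedWord σ
  have : {k | ∃ w, IsReducedWord w σ ∧ k = w.countP (fun i => i.val = 0)} =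
      {negCount (signAt σ)} := by
    ext k
    constructor
    · rintro ⟨w, hw, rfl⟩; exact (countP_of_isReducedWord hw).1
    · rintro rfl; exact ⟨w₀, h₀, (countP_of_isReducedWord h₀).1.symm⟩
  rw [length₁, this, csInf_singleton]

theorem length₂_eq (σ : hyperoctahedral n) :
    length₂ σ = pairInv (absPerm σ) (signAt σ) := by
  obtain ⟨w₀, h₀⟩ := exists_isReducedWord σ
  have : {k | ∃ w, IsReducedWord w σ ∧ k = w.countP (fun i => i.val ≠ 0)} =
      {pairInv (absPerm σ) (signAt σ)} := by
    ext k
    constructor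
    · rintro ⟨w, hw, rfl⟩; exact (countP_of_isReducedWord hw).2
    · rintro rfl; exact ⟨w₀, h₀, (countP_of_isReducedWord h₀).2.symm⟩
  rw [length₂, this, csInf_singleton]

theorem eq_one_of_inversions_eq_zero (σ : hyperoctahedral n) (h : inversions σ = 0) : σ = 1 :=
  eq_one_of_forall_inversions_le σ fun i => by rw [h]; exact Nat.zero_le _

end SignedPerm

/-! ### Positivity of the length function -/

/-- A product kernel of `±1`-valued functions that separate points is nondegenerate. -/
theorem isUnit_of_prod_kernel {W ι : Type*} [Fintype W] [DecidableEq W] [Fintype ι]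
    (χ : ι → W → Prop) (hχ : ∀ σ τ, (∀ h, χ h σ ↔ χ h τ) → σ = τ)
    (c : ι → ℝ) (hc : ∀ h, c h ∈ Set.Ioo (-1 : ℝ) 1) (M : Matrix W W ℝ)
    (hM : ∀ σ τ, M σ τ = ∏ h, (open Classical in if χ h σ ↔ χ h τ then 1 else c h)) :
    IsUnit M := by
  classical
  let e : ι → W → ℝ := fun h σ => if χ h σ then 1 else -1
  -- Each factor of the kernel equals `(1 + c h) / 2 + (1 - c h) / 2 * e h σ * e h τ`. Multiplied
  -- out, the product is a sum of rank one kernels, one for each set `S` of indices, with weight `C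
  -- S`; positivity of `C S` is where `-1 < c h < 1` enters.
  let C : Finset ι → ℝ := fun S =>
    (∏ h ∈ S, (1 - c h) / 2) * ∏ h ∈ Finset.univ \ S, (1 + c h) / 2
  have hC : ∀ S, 0 < C S := fun S => mul_pos
    (Finset.prod_pos fun h _ => by linarith [(hc h).2])
    (Finset.prod_pos fun h _ => by linarith [(hc h).1])
  have hexp : ∀ σ τ, M σ τ =
      ∑ S ∈ Finset.univ.powerset, C S * ((∏ h ∈ S, e h σ) * ∏ h ∈ S, e h τ) := by
    intro σ τ
    rw [hM]
    have : ∀ h, (if χ h σ ↔ χ h τ then 1 else c h) =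
        (1 - c h) / 2 * (e h σ * e h τ) + (1 + c h) / 2 := by
      intro h
      by_cases h₁ : χ h σ <;> by_cases h₂ : χ h τ <;> simp [e, h₁, h₂] <;> ring
    simp only [this]
    rw [Finset.prod_add]
    refine Finset.sum_congr rfl fun S _ => ?_
    simp only [C, Finset.prod_mul_distrib]
    ring
  rw [← Matrix.mulVec_injective_iff_isUnit, ← Matrix.coe_mulVecLin]
  rw [injective_iff_map_eq_zero]
  intro f hf
  have hf' : ∀ σ, ∑ τ, M σ τ * f τ = 0 := fun σ => congrFun hf σ
  -- The quadratic form of `M` at a kernel vector `f`, written as a positive combination of squares.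
  have hsq : ∑ S ∈ Finset.univ.powerset, C S * (∑ σ, f σ * ∏ h ∈ S, e h σ) ^ 2 = 0 := by
    calc _ = ∑ σ, f σ * ∑ τ, M σ τ * f τ := by
          simp only [hexp, sq, Finset.mul_sum, Finset.sum_mul]
          rw [Finset.sum_comm]
          refine Finset.sum_congr rfl fun σ _ => ?_
          rw [Finset.sum_comm]
          refine Finset.sum_congr rfl fun τ _ => ?_
          refine Finset.sum_congr rfl fun S _ => ?_
          ring
      _ = 0 := by simp [hf']
  have hzero : ∀ S : Finset ι, ∑ σ, f σ * ∏ h ∈ S, e h σ = 0 := by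
    intro S
    have := (Finset.sum_eq_zero_iff_of_nonneg
      (fun S _ => mul_nonneg (hC S).le (sq_nonneg _))).1 hsq S (by simp)
    simpa [(hC S).ne'] using this
  ext1 u
  -- Inversion of the transform: summing over all `S` produces the weight `∏ (1 + e h u * e h σ)`,
  -- which vanishes for `σ ≠ u` because the functions separate points, and is nonzero at `σ = u`.
  have h1 : ∑ S ∈ Finset.univ.powerset, (∏ h ∈ S, e h u) * ∑ σ, f σ * ∏ h ∈ S, e h σ = 0 := by
    simp [hzero]
  have h2 : ∑ S ∈ Finset.univ.powerset, (∏ h ∈ S, e h u) * ∑ σ, f σ * ∏ h ∈ S, e h σ =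
      ∑ σ, f σ * ∏ h, (e h u * e h σ + 1) := by
    simp only [Finset.prod_add, Finset.mul_sum]
    rw [Finset.sum_comm]
    refine Finset.sum_congr rfl fun σ _ => ?_
    refine Finset.sum_congr rfl fun S _ => ?_
    rw [Finset.prod_mul_distrib]
    simp
    ring
  rw [h1, Finset.sum_eq_single u] at h2
  · have h3 : ∏ h, (e h u * e h u + 1) ≠ 0 := by
      refine Finset.prod_ne_zero_iff.2 fun h _ => ?_
      by_cases h₁ : χ h u <;> norm_num [e, h₁]
    exact (mul_eq_zero.1 h2.symm).resolve_right h3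
  · intro σ _ hσ
    have : ∃ h, ¬(χ h u ↔ χ h σ) := by
      by_contra hcon
      push Not at hcon
      exact hσ (hχ u σ (fun h => by have := hcon h; tauto)).symm
    obtain ⟨h, hh⟩ := this
    rw [Finset.prod_eq_zero (Finset.mem_univ h), mul_zero]
    by_cases h₁ : χ h u <;> by_cases h₂ : χ h σ
    · exact absurd (by simp only [h₁, h₂]) hh
    · simp only [e, h₁, h₂, if_true, if_false]; norm_num
    · simp only [e, h₁, h₂, if_true, if_false]; norm_num
    · exact absurd (by simp only [h₁, h₂]) hh
  · simp

/-! ### Lengths as numbers of separating hyperplanes. -/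

section Hyperplanes

variable {n : ℕ}

/-- The integer `±(k + 1)` encoded by `(k, ±1)`. -/
def signedVal (a : Fin n × ℤˣ) : ℤ := (a.2 : ℤ) * (a.1.val + 1)

theorem signedVal_injective : Function.Injective (signedVal (n := n)) := by
  rintro ⟨i, s⟩ ⟨j, t⟩ h
  unfold signedVal at h
  rcases Int.units_eq_one_or s with rfl | rfl <;> rcases Int.units_eq_one_or t with rfl | rfl <;>
    simp only [Units.val_one, Units.val_neg] at h
  · exact Prod.ext (Fin.ext (by simp; omega)) rfl
  · omega
  · omega
  · exact Prod.ext (Fin.ext (by simp; omega)) rfl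

/-- The order that a signed permutation induces on `{±1, …, ±n}`. -/
def PreLT (σ : hyperoctahedral n) (a b : Fin n × ℤˣ) : Prop :=
  signedVal (σ.1 a) < signedVal (σ.1 b)

open Classical in
/-- Indicates that two signed permutations order two points differently. -/
def disagree (σ τ : hyperoctahedral n) (a b : Fin n × ℤˣ) : ℕ :=
  if PreLT σ a b ↔ PreLT τ a b then 0 else 1

theorem not_preLT_iff (σ : hyperoctahedral n) {a b : Fin n × ℤˣ} (h : a ≠ b) :
    ¬PreLT σ a b ↔ PreLT σ b a := by
  have : signedVal (σ.1 a) ≠ signedVal (σ.1 b) := fun h' =>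
    h (σ.1.injective (signedVal_injective h'))
  unfold PreLT
  omega

theorem preLT_neg (σ : hyperoctahedral n) (i j : Fin n) (s t : ℤˣ) :
    PreLT σ (i, -s) (j, -t) ↔ PreLT σ (j, t) (i, s) := by
  simp [PreLT, hyperoctahedral_apply, signedVal]

theorem disagree_comm (σ τ : hyperoctahedral n) (a b : Fin n × ℤˣ) :
    disagree σ τ a b = disagree σ τ b a := by
  by_cases h : a = b
  · rw [h]
  · have : (PreLT σ a b ↔ PreLT τ a b) ↔ (PreLT σ b a ↔ PreLT τ b a) := by
      rw [← not_preLT_iff σ h, ← not_preLT_iff τ h, not_iff_not]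
    unfold disagree; split_ifs <;> tauto

theorem disagree_neg (σ τ : hyperoctahedral n) (i j : Fin n) (s t : ℤˣ) :
    disagree σ τ (i, -s) (j, -t) = disagree σ τ (i, s) (j, t) := by
  rw [disagree_comm]
  unfold disagree
  rw [preLT_neg, preLT_neg]

theorem sum_units {M : Type*} [AddCommMonoid M] (f : ℤˣ → M) : ∑ s, f s = f 1 + f (-1) := by
  have : (Finset.univ : Finset ℤˣ) = {1, -1} := by decide
  rw [this, Finset.sum_pair (by decide)]

/-- The number of hyperplanes `x_i = ± x_j` that separate two signed permutations. -/
def separation (σ τ : hyperoctahedral n) : ℕ :=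
  ∑ i : Fin n, ∑ j : Fin n, ∑ t : ℤˣ, if i < j then disagree σ τ (j, 1) (i, t) else 0

/-- A hyperplane `x_i = ± x_j` is seen by four ordered pairs of signed points: exchanging the two
points or negating both does not change `disagree`. The full sum makes no choice `i < j`, so it can
be reindexed by any signed permutation. -/
theorem four_mul_separation (σ τ : hyperoctahedral n) :
    4 * separation σ τ =
      ∑ a : Fin n × ℤˣ, ∑ b : Fin n × ℤˣ, if a.1 ≠ b.1 then disagree σ τ a b else 0 := by
  let E : Fin n → Fin n → ℕ := fun i j => ∑ t : ℤˣ, disagree σ τ (j, 1) (i, t)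
  have hE : ∀ i j, E i j = E j i := by
    intro i j
    simp only [E, sum_units]
    rw [disagree_comm σ τ (j, 1) (i, 1), disagree_comm σ τ (j, 1) (i, -1),
      ← disagree_neg σ τ i j (-1) 1, neg_neg]
  have h1 : separation σ τ = ∑ i : Fin n, ∑ j : Fin n, if i < j then E i j else 0 := by
    refine Finset.sum_congr rfl fun i _ => Finset.sum_congr rfl fun j _ => ?_
    split_ifs <;> simp [E]
  have h2 : (∑ a : Fin n × ℤˣ, ∑ b : Fin n × ℤˣ, if a.1 ≠ b.1 then disagree σ τ a b else 0) =
      ∑ i : Fin n, ∑ j : Fin n, if i ≠ j then 2 * E i j else 0 := by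
    simp only [Fintype.sum_prod_type]
    refine Finset.sum_congr rfl fun i _ => ?_
    rw [Finset.sum_comm]
    refine Finset.sum_congr rfl fun j _ => ?_
    split_ifs
    · simp only [E, sum_units]
      rw [disagree_comm σ τ (j, 1) (i, 1), disagree_comm σ τ (j, 1) (i, -1),
        disagree_neg σ τ i j 1 1, ← disagree_neg σ τ i j 1 (-1), neg_neg]
      ring
    · simp
  have h3 : separation σ τ = ∑ i : Fin n, ∑ j : Fin n, if j < i then E i j else 0 := by
    rw [h1, Finset.sum_comm]
    refine Finset.sum_congr rfl fun i _ => Finset.sum_congr rfl fun j _ => ?_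
    rw [hE]
  have h4 : (∑ i : Fin n, ∑ j : Fin n, if i ≠ j then 2 * E i j else 0) =
      2 * ∑ i : Fin n, ∑ j : Fin n, ((if i < j then E i j else 0) +
        if j < i then E i j else 0) := by
    simp only [Finset.mul_sum]
    refine Finset.sum_congr rfl fun i _ => Finset.sum_congr rfl fun j _ => ?_
    rcases lt_trichotomy i j with h | h | h
    · simp [h, h.ne, h.not_gt]
    · simp [h]
    · simp [h, h.ne', h.not_gt]
  simp only [Finset.sum_add_distrib] at h4
  rw [h2, h4, ← h1, ← h3]
  ring

theorem separation_mul_right (σ τ ρ : hyperoctahedral n) :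
    separation (σ * ρ) (τ * ρ) = separation σ τ := by
  have h : 4 * separation (σ * ρ) (τ * ρ) = 4 * separation σ τ := by
    rw [four_mul_separation, four_mul_separation]
    symm
    rw [← Equiv.sum_comp ρ.1]
    refine Finset.sum_congr rfl fun a _ => ?_
    rw [← Equiv.sum_comp ρ.1]
    refine Finset.sum_congr rfl fun b _ => ?_
    have : (ρ.1 a).1 ≠ (ρ.1 b).1 ↔ a.1 ≠ b.1 := by
      obtain ⟨i, s⟩ := a
      obtain ⟨j, t⟩ := b
      simp [hyperoctahedral_apply]
    simp only [this]
    rfl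
  omega

/-- For `i < j` the identity puts `j` above both `i` and `-i`. If `|σ j| < |σ i|`, then `σ j` lies
below exactly one of `± σ i`; otherwise it lies below both or neither, according to its sign. These
are the values of `pairTerm`. -/
theorem separation_one (σ : hyperoctahedral n) :
    separation σ 1 = pairInv (absPerm σ) (signAt σ) := by
  unfold separation pairInv
  rw [Fintype.sum_prod_type]
  refine Finset.sum_congr rfl fun i _ => Finset.sum_congr rfl fun j _ => ?_
  unfold pairTerm
  by_cases hij : i < j
  swap
  · simp [hij]
  have h1 : ∀ t : ℤˣ, ¬PreLT (1 : hyperoctahedral n) (j, 1) (i, t) := by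
    intro t
    have : i.val < j.val := hij
    unfold PreLT
    rcases Int.units_eq_one_or t with rfl | rfl <;> simp [signedVal] <;> omega
  have hne : (absPerm σ i).val ≠ (absPerm σ j).val := by
    intro h; exact hij.ne ((absPerm σ).injective (Fin.ext h))
  simp only [hij, if_true, sum_units, disagree, h1, iff_false]
  simp only [PreLT, hyperoctahedral_apply, signedVal, mul_one, mul_neg]
  rcases Int.units_eq_one_or (signAt σ i) with h | h <;>
    rcases Int.units_eq_one_or (signAt σ j) with h' | h' <;>
    rw [h, h'] <;> simp only [Fin.lt_def] <;> push_cast <;> simp <;>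
    split_ifs <;> first | rfl | omega

/-- The number of hyperplanes `x_i = 0` that separate two signed permutations. -/
def signSeparation (σ τ : hyperoctahedral n) : ℕ :=
  Finset.card {k | signAt σ k ≠ signAt τ k}

theorem signSeparation_mul_right (σ τ ρ : hyperoctahedral n) :
    signSeparation (σ * ρ) (τ * ρ) = signSeparation σ τ := by
  unfold signSeparation
  refine Finset.card_equiv (absPerm ρ) fun k => ?_
  simp [signAt_mul]

theorem signSeparation_one (σ : hyperoctahedral n) :
    signSeparation σ 1 = negCount (signAt σ) := by
  unfold signSeparation negCount
  refine congrArg Finset.card (Finset.filter_congr fun k _ => ?_)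
  rcases Int.units_eq_one_or (signAt σ k) with h | h <;> rw [h, signAt_one] <;> decide

/-- Both separation numbers are invariant under right multiplication, so `τ` may be moved to the
identity. -/
theorem lengths_mul_inv (σ τ : hyperoctahedral n) :
    length₁ (σ * τ⁻¹) = signSeparation σ τ ∧ length₂ (σ * τ⁻¹) = separation σ τ := by
  rw [length₁_eq, length₂_eq, ← separation_one, ← signSeparation_one]
  constructor
  · rw [← signSeparation_mul_right _ _ τ]; simp
  · rw [← separation_mul_right _ _ τ]; simp

/-- The kernel `α^{l₁(σ τ⁻¹)} q^{l₂(σ τ⁻¹)}` is nondegenerate. -/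
theorem isUnit_lengthKernel {α q : ℝ} (hα : α ∈ Set.Ioo (-1 : ℝ) 1) (hq : q ∈ Set.Ioo (-1 : ℝ) 1) :
    IsUnit (Matrix.of fun σ τ : hyperoctahedral n =>
      α ^ length₁ (σ * τ⁻¹) * q ^ length₂ (σ * τ⁻¹)) := by
  classical
  -- The function of `h` tells the side of the hyperplane on which `σ` lies. Triples without `i < j`
  -- have the constant value `False`, so they contribute the factor 1.
  let χ : Fin n ⊕ (Fin n × Fin n × ℤˣ) → hyperoctahedral n → Prop := fun h σ =>
    h.elim (fun k => signAt σ k = 1) (fun b => b.1 < b.2.1 ∧ PreLT σ (b.2.1, 1) (b.1, b.2.2))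
  let c : Fin n ⊕ (Fin n × Fin n × ℤˣ) → ℝ := fun h => h.elim (fun _ => α) (fun _ => q)
  have hsign : ∀ (σ τ : hyperoctahedral n) k,
      (signAt σ k = 1 ↔ signAt τ k = 1) ↔ signAt σ k = signAt τ k := by
    intro σ τ k
    rcases Int.units_eq_one_or (signAt σ k) with h | h <;>
      rcases Int.units_eq_one_or (signAt τ k) with h' | h' <;> rw [h, h'] <;> decide
  refine isUnit_of_prod_kernel χ ?_ c ?_ _ ?_
  · intro σ τ h
    obtain ⟨h1, h2⟩ := lengths_mul_inv σ τ
    rw [length₁_eq] at h1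
    rw [length₂_eq] at h2
    have h3 : signSeparation σ τ = 0 := by
      simp only [signSeparation, Finset.card_eq_zero, Finset.filter_eq_empty_iff]
      intro k _ hk
      exact hk ((hsign σ τ k).1 (h (Sum.inl k)))
    have h4 : separation σ τ = 0 := by
      simp only [separation, Finset.sum_eq_zero_iff]
      intro i _ j _ t _
      split_ifs with hij
      · have := h (Sum.inr (i, j, t))
        simp only [χ, Sum.elim_inr, hij, true_and] at this
        simp [disagree, this]
      · rfl
    -- No hyperplane separates `σ` and `τ`, so both lengths of `σ τ⁻¹` vanish.
    have := eq_one_of_inversions_eq_zero (σ * τ⁻¹) (by rw [inversions]; omega)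
    exact mul_inv_eq_one.1 this
  · rintro (k | b)
    · exact hα
    · exact hq
  · intro σ τ
    obtain ⟨h1, h2⟩ := lengths_mul_inv σ τ
    rw [Matrix.of_apply, h1, h2, Fintype.prod_sum_type]
    congr 1
    · simp only [χ, c, Sum.elim_inl, hsign, Finset.prod_ite, Finset.prod_const, one_pow, one_mul]
      rfl
    · simp only [separation, ← Finset.prod_pow_eq_pow_sum, Fintype.prod_prod_type]
      refine Finset.prod_congr rfl fun i _ => Finset.prod_congr rfl fun j _ =>
        Finset.prod_congr rfl fun t _ => ?_
      by_cases hij : i < j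
      · by_cases hd : PreLT σ (j, 1) (i, t) ↔ PreLT τ (j, 1) (i, t)
        · simp [χ, hij, hd, disagree]
        · simp [χ, c, hij, hd, disagree]
      · simp [χ, hij]

end Hyperplanes

/-! ### Nondegeneracy of the inner products -/

section Nondegenerate

variable {H : Type*} [NormedAddCommGroup H] [InnerProductSpace ℂ H]

/-- A tensor involves finitely many vectors. Their span has an orthonormal basis, in which
`eq_zero_of_tensorInner_tprod` expands the tensor. -/
theorem exists_span_tprod (n : ℕ) (t : ⨂[ℂ]^n H) :
    ∃ E : Submodule ℂ H, FiniteDimensional ℂ E ∧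
      t ∈ Submodule.span ℂ {u | ∃ v : Fin n → H, (∀ i, v i ∈ E) ∧ PiTensorProduct.tprod ℂ v = u} := by
  induction t using PiTensorProduct.induction_on with
  | smul_tprod r v =>
    refine ⟨Submodule.span ℂ (Set.range v), FiniteDimensional.span_of_finite ℂ (Set.finite_range v),
      Submodule.smul_mem _ _ (Submodule.subset_span ⟨v, fun i => ?_, rfl⟩)⟩
    exact Submodule.subset_span ⟨i, rfl⟩
  | add a b ha hb =>
    obtain ⟨E, hE, ha⟩ := ha
    obtain ⟨F, hF, hb⟩ := hb
    refine ⟨E ⊔ F, inferInstance, Submodule.add_mem _ ?_ ?_⟩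
    · refine Submodule.span_mono ?_ ha
      rintro u ⟨v, hv, rfl⟩
      exact ⟨v, fun i => Submodule.mem_sup_left (hv i), rfl⟩
    · refine Submodule.span_mono ?_ hb
      rintro u ⟨v, hv, rfl⟩
      exact ⟨v, fun i => Submodule.mem_sup_right (hv i), rfl⟩

/-- A tensor that is orthogonal to all pure tensors vanishes. -/
theorem eq_zero_of_tensorInner_tprod (n : ℕ) (t : ⨂[ℂ]^n H)
    (h : ∀ v : Fin n → H, tensorInner n (PiTensorProduct.tprod ℂ v) t = 0) : t = 0 := by
  obtain ⟨E, hE, ht⟩ := exists_span_tprod n t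
  let e := stdOrthonormalBasis ℂ E
  -- The coefficients in the product basis are inner products with pure tensors, so all of them
  -- vanish by `h`.
  have key : t = ∑ I : Fin n → Fin (Module.finrank ℂ E),
      tensorInner n (PiTensorProduct.tprod ℂ fun k => (e (I k) : H)) t •
        PiTensorProduct.tprod ℂ fun k => (e (I k) : H) := by
    clear h
    induction ht using Submodule.span_induction with
    | mem u hu =>
      obtain ⟨v, hv, rfl⟩ := hu
      have hv' : v = fun i => ∑ j, ⟪(e j : H), v i⟫_ℂ • (e j : H) := by
        ext1 i
        have := congrArg (Subtype.val) (e.sum_repr' ⟨v i, hv i⟩)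
        simpa using this.symm
      conv_lhs => rw [hv', MultilinearMap.map_sum]
      refine Finset.sum_congr rfl fun I _ => ?_
      rw [MultilinearMap.map_smul_univ, tensorInner_tprod]
    | zero => simp
    | add a b _ _ ha hb =>
      simp only [map_add, add_smul, Finset.sum_add_distrib]
      rw [← ha, ← hb]
    | smul c a _ ha =>
      simp only [map_smul, smul_assoc, ← Finset.smul_sum]
      rw [← ha]
  rw [key]
  simp [h]

/-- A factor that changes sign under both `τ` and `σ` receives `J` twice; involutivity of `J` makes
this the identity, in accordance with the product of signs. -/
theorem groupAction_mul {J : H →ₗ[ℂ] H} (hJ : Function.Involutive J) {n : ℕ}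
    (σ τ : hyperoctahedral n) : groupAction J (σ * τ) = groupAction J σ ∘ₗ groupAction J τ := by
  apply PiTensorProduct.ext
  ext x
  simp only [LinearMap.compMultilinearMap_apply, LinearMap.comp_apply, groupAction_tprod]
  congr 1
  ext1 j
  have h : (absPerm (σ * τ)).symm j = (absPerm τ).symm ((absPerm σ).symm j) := by
    rw [absPerm_mul]; rfl
  have h1 := signAt_mul σ τ ((absPerm (σ * τ)).symm j)
  rw [h] at *
  rw [Equiv.apply_symm_apply] at h1
  change (if signAt _ _ = 1 then LinearMap.id else J : H →ₗ[ℂ] H) _ =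
    (if signAt _ _ = 1 then LinearMap.id else J : H →ₗ[ℂ] H)
      ((if signAt _ _ = 1 then LinearMap.id else J : H →ₗ[ℂ] H) _)
  rw [h1]
  have hne : (-1 : ℤˣ) ≠ 1 := by decide
  rcases Int.units_eq_one_or (signAt σ ((absPerm σ).symm j)) with h | h <;>
    rcases Int.units_eq_one_or (signAt τ ((absPerm τ).symm ((absPerm σ).symm j))) with h' | h' <;>
    rw [h, h'] <;> simp [hne, hJ _]

theorem groupAction_one (J : H →ₗ[ℂ] H) {n : ℕ} :
    groupAction J (1 : hyperoctahedral n) = LinearMap.id := by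
  apply PiTensorProduct.ext
  ext x
  simp only [LinearMap.compMultilinearMap_apply, groupAction_tprod, absPerm_one]
  simp
  rfl

/-- The symmetrization operator is injective. -/
theorem eq_zero_of_symmetrizer_eq_zero {J : H →ₗ[ℂ] H} (hJ : Function.Involutive J) {α q : ℝ}
    (hα : α ∈ Set.Ioo (-1 : ℝ) 1) (hq : q ∈ Set.Ioo (-1 : ℝ) 1) {n : ℕ} (t : ⨂[ℂ]^n H)
    (ht : symmetrizer J α q n t = 0) : t = 0 := by
  classical
  let φ : hyperoctahedral n → ℝ := fun σ => α ^ length₁ σ * q ^ length₂ σ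
  obtain ⟨⟨M, N, _, hNM⟩, hM⟩ := isUnit_lengthKernel (n := n) hα hq
  replace hM : ∀ ρ τ, M ρ τ = φ (ρ * τ⁻¹) := by
    intro ρ τ
    change M = _ at hM
    rw [hM]; rfl
  -- This is `ρ⁻¹` applied to the symmetrization of `t`, with the summation variable written as `ρ
  -- τ⁻¹`. Thus the scalar matrix `M` annihilates the family of vectors `τ⁻¹ t`.
  have h1 : ∀ ρ : hyperoctahedral n, ∑ τ, (M ρ τ : ℂ) • groupAction J τ⁻¹ t = 0 := by
    intro ρ
    have h2 : groupAction J ρ⁻¹ (symmetrizer J α q n t) = 0 := by rw [ht, map_zero]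
    rw [← h2, symmetrizer, LinearMap.sum_apply, map_sum]
    refine Fintype.sum_equiv ((Equiv.inv _).trans (Equiv.mulLeft ρ)) _ _ fun τ => ?_
    rw [hM]
    simp only [Equiv.trans_apply, Equiv.inv_apply, Equiv.coe_mulLeft, LinearMap.smul_apply,
      map_smul]
    rw [← LinearMap.comp_apply, ← groupAction_mul hJ, inv_mul_cancel_left]
    simp [φ]
  -- The row of the identity in the inverse matrix `N` extracts the entry at `τ = 1`, which is `t`.
  have h3 : ∑ ρ, (N 1 ρ : ℂ) • ∑ τ, (M ρ τ : ℂ) • groupAction J τ⁻¹ t = 0 := by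
    simp only [h1, smul_zero, Finset.sum_const_zero]
  simp only [Finset.smul_sum, smul_smul] at h3
  rw [Finset.sum_comm] at h3
  simp only [← Finset.sum_smul] at h3
  have h4 : ∀ τ, ∑ ρ, (N 1 ρ : ℂ) * (M ρ τ : ℂ) = if 1 = τ then 1 else 0 := by
    intro τ
    have := congrFun (congrFun hNM 1) τ
    rw [Matrix.mul_apply, Matrix.one_apply] at this
    rw [← Complex.ofReal_one, ← Complex.ofReal_zero, ← apply_ite, ← this]
    push_cast
    rfl
  simpa [h4, groupAction_one] using h3

theorem fockInner_lof (J : H →ₗ[ℂ] H) (α q : ℝ) {n : ℕ} (f : ⨂[ℂ]^n H) (g : Fock H) :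
    fockInner J α q (DirectSum.lof ℂ ℕ (fun n => ⨂[ℂ]^n H) n f) g =
      tensorInner n f (symmetrizer J α q n (g n)) := by
  unfold fockInner
  induction g using DirectSum.induction_on with
  | zero => simp
  | of m y =>
    rw [← DirectSum.lof_eq_of ℂ, DirectSum.toModule_lof]
    by_cases h : n = m
    · subst h
      simp [DirectSum.lof_apply]
    · have h1 : (DirectSum.lof ℂ ℕ (fun n => ⨂[ℂ]^n H) n f) m = 0 :=
        DirectSum.of_eq_of_ne _ _ _ (Ne.symm h)
      have h2 : (DirectSum.lof ℂ ℕ (fun n => ⨂[ℂ]^n H) m y) n = 0 :=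
        DirectSum.of_eq_of_ne _ _ _ h
      rw [h1, h2]; simp
  | add a b ha hb => rw [map_add, ha, hb, DirectSum.add_apply, map_add, map_add]

theorem fockInner_add_left (J : H →ₗ[ℂ] H) (α q : ℝ) (f f' g : Fock H) :
    fockInner J α q (f + f') g = fockInner J α q f g + fockInner J α q f' g := by
  unfold fockInner
  rw [← LinearMap.add_apply]
  congr 1
  ext : 1
  ext : 1
  ext x
  simp

theorem fockInner_zero_left (J : H →ₗ[ℂ] H) (α q : ℝ) (g : Fock H) :
    fockInner J α q 0 g = 0 := by
  have := fockInner_add_left J α q 0 0 g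
  simpa using this

/-- The deformed inner product is nondegenerate. -/
theorem eq_zero_of_fockInner_eq_zero {J : H →ₗ[ℂ] H} (hJ : Function.Involutive J) {α q : ℝ}
    (hα : α ∈ Set.Ioo (-1 : ℝ) 1) (hq : q ∈ Set.Ioo (-1 : ℝ) 1) (g : Fock H)
    (hg : ∀ f, fockInner J α q f g = 0) : g = 0 := by
  refine DFinsupp.ext fun n => ?_
  refine eq_zero_of_symmetrizer_eq_zero hJ hα hq _ ?_
  refine eq_zero_of_tensorInner_tprod n _ fun v => ?_
  rw [← fockInner_lof, hg]

theorem fockInner_sub_right (J : H →ₗ[ℂ] H) (α q : ℝ) (f g g' : Fock H) :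
    fockInner J α q f (g - g') = fockInner J α q f g - fockInner J α q f g' := by
  unfold fockInner
  rw [map_sub]

theorem IsCreationAdjoint.unique {J : H →ₗ[ℂ] H} (hJ : Function.Involutive J) {α q : ℝ}
    (hα : α ∈ Set.Ioo (-1 : ℝ) 1) (hq : q ∈ Set.Ioo (-1 : ℝ) 1) {x : H}
    {T T' : Module.End ℂ (Fock H)} (hT : IsCreationAdjoint J α q x T)
    (hT' : IsCreationAdjoint J α q x T') : T = T' := by
  refine LinearMap.ext fun g => sub_eq_zero.1 (eq_zero_of_fockInner_eq_zero hJ hα hq _ fun f => ?_)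
  rw [fockInner_sub_right, ← hT, ← hT', sub_self]

end Nondegenerate

/-! ### The annihilation operator -/

section CosetDecomposition

variable {n : ℕ}

/-- The permutation that sends `k` to the last position and is given by `p` elsewhere. -/
def insertPerm (k : Fin (n + 1)) (p : Equiv.Perm (Fin n)) : Equiv.Perm (Fin (n + 1)) :=
  (finSuccEquiv' k).trans ((Equiv.optionCongr p).trans (finSuccEquiv' (Fin.last n)).symm)

@[simp] theorem insertPerm_self (k : Fin (n + 1)) (p : Equiv.Perm (Fin n)) :
    insertPerm k p k = Fin.last n := by
  simp [insertPerm]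

@[simp] theorem insertPerm_succAbove (k : Fin (n + 1)) (p : Equiv.Perm (Fin n)) (i : Fin n) :
    insertPerm k p (k.succAbove i) = (p i).castSucc := by
  simp [insertPerm]

theorem insertPerm_bijective (n : ℕ) : Function.Bijective
    (fun a : Fin (n + 1) × Equiv.Perm (Fin n) => insertPerm a.1 a.2) := by
  rw [Fintype.bijective_iff_injective_and_card]
  constructor
  · rintro ⟨k, p⟩ ⟨l, r⟩ h
    change insertPerm k p = insertPerm l r at h
    have hk : k = l := by
      apply (insertPerm k p).injective
      rw [insertPerm_self, h, insertPerm_self]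
    subst hk
    congr 1
    ext1 i
    have := congrArg (fun e : Equiv.Perm (Fin (n + 1)) => e (k.succAbove i)) h
    simpa using this
  · rw [Fintype.card_prod, Fintype.card_fin, Fintype.card_perm, Fintype.card_perm,
      Fintype.card_fin, Fintype.card_fin, Nat.factorial_succ]

theorem sum_perm_succ {M : Type*} [AddCommMonoid M] (F : Equiv.Perm (Fin (n + 1)) → M) :
    ∑ p, F p = ∑ k, ∑ p, F (insertPerm k p) := by
  rw [← Fintype.sum_prod_type']
  exact ((insertPerm_bijective n).sum_comp F).symm

theorem sum_sign_succ {M : Type*} [AddCommMonoid M] (k : Fin (n + 1))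
    (F : (Fin (n + 1) → ℤˣ) → M) :
    ∑ s, F s = ∑ s : Fin n → ℤˣ, ∑ t, F (k.insertNth t s) := by
  rw [Finset.sum_comm, ← Fintype.sum_prod_type', ← Equiv.sum_comp (Fin.insertNthEquiv _ k)]
  rfl

theorem negCount_insertNth (k : Fin (n + 1)) (t : ℤˣ) (s : Fin n → ℤˣ) :
    negCount (k.insertNth t s : Fin (n + 1) → ℤˣ) = (if t = -1 then 1 else 0) + negCount s := by
  simp only [negCount, Finset.card_filter, Fin.sum_univ_succAbove _ k, Fin.insertNth_apply_same,
    Fin.insertNth_apply_succAbove]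

theorem card_lt_succAbove (k : Fin (n + 1)) :
    ∑ i : Fin n, (if k < k.succAbove i then 1 else 0) = n - k.val := by
  have h : ∀ i : Fin n, k < k.succAbove i ↔ k ≤ i.castSucc := fun i =>
    Fin.lt_succAbove_iff_le_castSucc k i
  simp only [h, ← Finset.card_filter]
  have := Finset.card_map (s := Finset.univ.filter fun i : Fin n => k ≤ i.castSucc) Fin.valEmbedding
  rw [← this, ← Nat.card_Ico]
  congr 1
  ext m
  simp only [Finset.mem_map, Finset.mem_filter, Finset.mem_univ, true_and, Fin.valEmbedding_apply,
    Finset.mem_Ico, Fin.le_def, Fin.val_castSucc]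
  exact ⟨by rintro ⟨a, ha, rfl⟩; exact ⟨ha, a.isLt⟩, fun h => ⟨⟨m, h.2⟩, h.1, rfl⟩⟩

theorem card_succAbove_lt (k : Fin (n + 1)) :
    ∑ i : Fin n, (if k.succAbove i < k then 1 else 0) = k.val := by
  have h : ∑ i : Fin n, ((if k < k.succAbove i then 1 else 0) +
      (if k.succAbove i < k then 1 else 0)) = n := by
    rw [Finset.sum_congr rfl (g := fun _ => 1), Finset.sum_const]
    · simp
    · intro i _
      rcases lt_or_gt_of_ne (Fin.succAbove_ne k i) with h | h
      · simp [h, h.not_gt]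
      · simp [h, h.not_gt]
  rw [Finset.sum_add_distrib, card_lt_succAbove] at h
  have := k.isLt
  omega

/-- Position `k` takes the largest value. It is inverted with each of the `n - k` later positions,
and with each of the `k` earlier ones it counts 2 if its sign is negative; in that case `(n - k) + 2
k = n + k`. -/
theorem pairInv_insert (k : Fin (n + 1)) (p : Equiv.Perm (Fin n)) (t : ℤˣ) (s : Fin n → ℤˣ) :
    pairInv (insertPerm k p) (k.insertNth t s) =
      (if t = -1 then n + k.val else n - k.val) + pairInv p s := by
  unfold pairInv
  rw [Fintype.sum_prod_type, Fintype.sum_prod_type, Fin.sum_univ_succAbove _ k]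
  simp only [Fin.sum_univ_succAbove _ k]
  rw [Finset.sum_add_distrib]
  have h1 : pairTerm (insertPerm k p) (k.insertNth t s) (k, k) = 0 := by simp [pairTerm]
  have h2 : ∀ i, pairTerm (insertPerm k p) (k.insertNth t s) (k, k.succAbove i) =
      if k < k.succAbove i then 1 else 0 := by
    intro i; simp [pairTerm, Fin.castSucc_lt_last]
  have h3 : ∀ i, pairTerm (insertPerm k p) (k.insertNth t s) (k.succAbove i, k) =
      (if t = -1 then 2 else 0) * if k.succAbove i < k then 1 else 0 := by
    intro i; simp [pairTerm, (Fin.castSucc_lt_last _).not_gt]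
  have h4 : ∀ i j, pairTerm (insertPerm k p) (k.insertNth t s) (k.succAbove i, k.succAbove j) =
      pairTerm p s (i, j) := by
    intro i j; simp [pairTerm]
  simp only [h1, h2, h3, h4]
  rw [← Finset.mul_sum, card_lt_succAbove, card_succAbove_lt]
  have := k.isLt
  split_ifs <;> omega

end CosetDecomposition

/-! ### The adjoint of the creation operator in closed form. -/

section Annihilation

variable {H : Type*} [NormedAddCommGroup H] [InnerProductSpace ℂ H]

/-- The identity or the involution, according to a sign. -/
def signMap (J : H →ₗ[ℂ] H) (t : ℤˣ) : H →ₗ[ℂ] H := if t = 1 then LinearMap.id else J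

theorem tensorInner_symmetrizer (J : H →ₗ[ℂ] H) (α q : ℝ) {n : ℕ} (y v : Fin n → H) :
    tensorInner n (PiTensorProduct.tprod ℂ y) (symmetrizer J α q n (PiTensorProduct.tprod ℂ v)) =
      ∑ p, ∑ s, (α : ℂ) ^ negCount s * (q : ℂ) ^ pairInv p s *
        ∏ i, ⟪y (p i), signMap J (s i) (v i)⟫_ℂ := by
  rw [← Fintype.sum_prod_type', symmetrizer, LinearMap.sum_apply, map_sum]
  refine Fintype.sum_equiv (signedPermEquiv n) _ _ fun σ => ?_
  rw [LinearMap.smul_apply, map_smul, groupAction_tprod, tensorInner_tprod, smul_eq_mul,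
    length₁_eq, length₂_eq, ← Equiv.prod_comp (absPerm σ)]
  simp only [Equiv.symm_apply_apply]
  rfl

/-- The coefficient of the `k`-th term of the annihilation operator. -/
def annihForm (J : H →ₗ[ℂ] H) (α q : ℝ) (x : H) (n k : ℕ) : H →ₗ[ℂ] ℂ :=
  (q : ℂ) ^ (n - k) • innerₛₗ ℂ x + ((α : ℂ) * (q : ℂ) ^ (n + k)) • (innerₛₗ ℂ x ∘ₗ J)

theorem annihForm_apply (J : H →ₗ[ℂ] H) (α q : ℝ) (x : H) (n k : ℕ) (z : H) :
    annihForm J α q x n k z =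
      (q : ℂ) ^ (n - k) * ⟪x, z⟫_ℂ + (α : ℂ) * (q : ℂ) ^ (n + k) * ⟪x, J z⟫_ℂ := by
  simp [annihForm]

/-- The annihilation operator on `H^{⊗ (n + 1)}`. -/
def annihTensor (J : H →ₗ[ℂ] H) (α q : ℝ) (x : H) (n : ℕ) :
    (⨂[ℂ]^(n + 1) H) →ₗ[ℂ] (⨂[ℂ]^n H) :=
  PiTensorProduct.lift (∑ k : Fin (n + 1), LinearMap.uncurryMid (M := fun _ => H) k
    ((annihForm J α q x n k).smulRight (PiTensorProduct.tprod ℂ)))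

theorem annihTensor_tprod (J : H →ₗ[ℂ] H) (α q : ℝ) (x : H) (n : ℕ) (v : Fin (n + 1) → H) :
    annihTensor J α q x n (PiTensorProduct.tprod ℂ v) =
      ∑ k : Fin (n + 1), annihForm J α q x n k (v k) •
        PiTensorProduct.tprod ℂ (fun i => v (k.succAbove i)) := by
  rw [annihTensor, PiTensorProduct.lift.tprod, sum_apply]
  rfl

theorem appendTensor_tprod (x : H) (n : ℕ) (v : Fin n → H) :
    appendTensor x n (PiTensorProduct.tprod ℂ v) =
      PiTensorProduct.tprod ℂ (Fin.snoc v x : Fin (n + 1) → H) := by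
  simp [appendTensor]

/-- The signed permutations are sorted by the index `k` of the factor that meets `x` in the last
place. The two signs at `k` give the two terms of `annihForm`, and the remaining data run through
the symmetrizer of degree `n`. -/
theorem tensorInner_appendTensor_tprod (J : H →ₗ[ℂ] H) (α q : ℝ) (x : H) {n : ℕ}
    (y : Fin n → H) (v : Fin (n + 1) → H) :
    tensorInner (n + 1) (appendTensor x n (PiTensorProduct.tprod ℂ y))
        (symmetrizer J α q (n + 1) (PiTensorProduct.tprod ℂ v)) =
      tensorInner n (PiTensorProduct.tprod ℂ y)
        (symmetrizer J α q n (annihTensor J α q x n (PiTensorProduct.tprod ℂ v))) := by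
  rw [appendTensor_tprod, tensorInner_symmetrizer, sum_perm_succ, annihTensor_tprod, map_sum,
    map_sum]
  refine Finset.sum_congr rfl fun k _ => ?_
  rw [map_smul, map_smul, tensorInner_symmetrizer, smul_eq_mul, Finset.mul_sum]
  refine Finset.sum_congr rfl fun p _ => ?_
  rw [sum_sign_succ k, Finset.mul_sum]
  refine Finset.sum_congr rfl fun s _ => ?_
  have hne : (1 : ℤˣ) ≠ -1 := by decide
  rw [sum_units, annihForm_apply]
  simp only [negCount_insertNth, pairInv_insert, Fin.prod_univ_succAbove _ k, insertPerm_self,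
    Fin.insertNth_apply_same, Fin.insertNth_apply_succAbove, insertPerm_succAbove, Fin.snoc_last,
    Fin.snoc_castSucc, hne, hne.symm, if_true, if_false, signMap, LinearMap.id_apply, pow_add]
  ring

theorem tensorInner_appendTensor (J : H →ₗ[ℂ] H) (α q : ℝ) (x : H) {n : ℕ}
    (u : ⨂[ℂ]^n H) (w : ⨂[ℂ]^(n + 1) H) :
    tensorInner (n + 1) (appendTensor x n u) (symmetrizer J α q (n + 1) w) =
      tensorInner n u (symmetrizer J α q n (annihTensor J α q x n w)) := by
  induction u using PiTensorProduct.induction_on with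
  | smul_tprod r y =>
    simp only [map_smul, map_smulₛₗ, LinearMap.smul_apply]
    congr 1
    induction w using PiTensorProduct.induction_on with
    | smul_tprod r v => simp only [map_smul, tensorInner_appendTensor_tprod]
    | add a b ha hb => simp only [map_add, ha, hb]
  | add a b ha hb => simp only [map_add, LinearMap.add_apply, ha, hb]

/-- The annihilation operator, in closed form. -/
def annihOp (J : H →ₗ[ℂ] H) (α q : ℝ) (x : H) : Module.End ℂ (Fock H) :=
  DirectSum.toModule ℂ ℕ (Fock H) fun n => match n with
    | 0 => 0
    | n + 1 => DirectSum.lof ℂ ℕ (fun n => ⨂[ℂ]^n H) n ∘ₗ annihTensor J α q x n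

theorem annihOp_lof_succ (J : H →ₗ[ℂ] H) (α q : ℝ) (x : H) (n : ℕ) (u : ⨂[ℂ]^(n + 1) H) :
    annihOp J α q x (DirectSum.lof ℂ ℕ (fun n => ⨂[ℂ]^n H) (n + 1) u) =
      DirectSum.lof ℂ ℕ (fun n => ⨂[ℂ]^n H) n (annihTensor J α q x n u) := by
  rw [annihOp, DirectSum.toModule_lof]
  rfl

theorem annihOp_lof_zero (J : H →ₗ[ℂ] H) (α q : ℝ) (x : H) (u : ⨂[ℂ]^0 H) :
    annihOp J α q x (DirectSum.lof ℂ ℕ (fun n => ⨂[ℂ]^n H) 0 u) = 0 := by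
  rw [annihOp, DirectSum.toModule_lof]
  rfl

theorem annihOp_apply (J : H →ₗ[ℂ] H) (α q : ℝ) (x : H) (g : Fock H) (n : ℕ) :
    annihOp J α q x g n = annihTensor J α q x n (g (n + 1)) := by
  induction g using DirectSum.induction_on with
  | zero => simp
  | of m y =>
    rw [← DirectSum.lof_eq_of ℂ]
    cases m with
    | zero =>
      have : (DirectSum.lof ℂ ℕ (fun n => ⨂[ℂ]^n H) 0 y) (n + 1) = 0 :=
        DirectSum.of_eq_of_ne _ _ _ (Nat.succ_ne_zero n)
      rw [annihOp_lof_zero, this]; simp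
    | succ m =>
      rw [annihOp_lof_succ]
      by_cases h : m = n
      · subst h
        simp [DirectSum.lof_apply]
      · have h1 : (DirectSum.lof ℂ ℕ (fun n => ⨂[ℂ]^n H) (m + 1) y) (n + 1) = 0 :=
          DirectSum.of_eq_of_ne _ _ _ (fun h' => h (Nat.succ.inj h').symm)
        have h2 : (DirectSum.lof ℂ ℕ (fun n => ⨂[ℂ]^n H) m (annihTensor J α q x m y)) n = 0 :=
          DirectSum.of_eq_of_ne _ _ _ (Ne.symm h)
        rw [h1, h2, map_zero]
  | add a b ha hb => rw [map_add, DirectSum.add_apply, DirectSum.add_apply, ha, hb, map_add]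

theorem isCreationAdjoint_annihOp (J : H →ₗ[ℂ] H) (α q : ℝ) (x : H) :
    IsCreationAdjoint J α q x (annihOp J α q x) := by
  intro f g
  induction f using DirectSum.induction_on with
  | zero => rw [map_zero, fockInner_zero_left, fockInner_zero_left]
  | of n u =>
    rw [← DirectSum.lof_eq_of ℂ, fockInner_lof, annihOp_apply, creation, DirectSum.toModule_lof,
      LinearMap.comp_apply, fockInner_lof, tensorInner_appendTensor]
  | add a b ha hb => rw [map_add, fockInner_add_left, fockInner_add_left, ha, hb]

theorem annihilation_eq {J : H →ₗ[ℂ] H} (hJ : Function.Involutive J) {α q : ℝ}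
    (hα : α ∈ Set.Ioo (-1 : ℝ) 1) (hq : q ∈ Set.Ioo (-1 : ℝ) 1) (x : H) : annihilation J α q x = annihOp J α q x := by
  have h : ∃ T, IsCreationAdjoint J α q x T := ⟨_, isCreationAdjoint_annihOp J α q x⟩
  rw [annihilation, dif_pos h]
  exact h.choose_spec.unique hJ hα hq (isCreationAdjoint_annihOp J α q x)

/-- The annihilation operator is the unique adjoint of the creation operator. -/
theorem isCreationAdjoint_iff {J : H →ₗ[ℂ] H} (hJ : Function.Involutive J) {α q : ℝ}
    (hα : α ∈ Set.Ioo (-1 : ℝ) 1) (hq : q ∈ Set.Ioo (-1 : ℝ) 1) (x : H) (T : Module.End ℂ (Fock H)) :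
    IsCreationAdjoint J α q x T ↔ T = annihilation J α q x := by
  rw [annihilation_eq hJ hα hq]
  constructor
  · exact fun h => h.unique hJ hα hq (isCreationAdjoint_annihOp J α q x)
  · rintro rfl; exact isCreationAdjoint_annihOp J α q x

end Annihilation

/-! ### Pairings of natural numbers -/

section Diagrams

/-- The `i < n` that belong to no pair of `P`. -/
def openPoints (n : ℕ) (P : Finset (ℕ × ℕ)) : Finset ℕ :=
  (Finset.range n).filter fun i => ∀ v ∈ P, i ≠ v.1 ∧ i ≠ v.2

theorem mem_openPoints {n : ℕ} {P : Finset (ℕ × ℕ)} {i : ℕ} :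
    i ∈ openPoints n P ↔ i < n ∧ ∀ v ∈ P, i ≠ v.1 ∧ i ≠ v.2 := by
  simp [openPoints]

/-- `P` is the set of the pairs `(a, b)`, `a < b`, of a partition of `{0, …, n - 1}` in pairs and
singletons compatible with `ε`. -/
structure IsDiagram (ε : ℕ → Exponent) (n : ℕ) (P : Finset (ℕ × ℕ)) : Prop where
  lt : ∀ v ∈ P, v.1 < v.2
  bound : ∀ v ∈ P, v.2 < n
  star : ∀ v ∈ P, ε v.1 = .star
  one : ∀ v ∈ P, ε v.2 = .one
  inj₁ : ∀ v ∈ P, ∀ w ∈ P, v.1 = w.1 → v = w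
  inj₂ : ∀ v ∈ P, ∀ w ∈ P, v.2 = w.2 → v = w
  cover : ∀ i < n, ε i = .one → ∃ v ∈ P, v.2 = i

open Classical in
/-- The finite set of all the diagrams. -/
def diagrams (ε : ℕ → Exponent) (n : ℕ) : Finset (Finset (ℕ × ℕ)) :=
  (Finset.range n ×ˢ Finset.range n).powerset.filter (IsDiagram ε n)

variable {ε : ℕ → Exponent} {n : ℕ} {P : Finset (ℕ × ℕ)}

theorem mem_diagrams : P ∈ diagrams ε n ↔ IsDiagram ε n P := by
  simp only [diagrams, Finset.mem_filter, Finset.mem_powerset, and_iff_right_iff_imp]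
  intro h v hv
  have h1 := h.lt v hv
  have h2 := h.bound v hv
  simp only [Finset.mem_product, Finset.mem_range]
  omega

theorem diagrams_zero : diagrams ε 0 = {∅} := by
  ext P
  rw [mem_diagrams, Finset.mem_singleton]
  constructor
  · intro h
    exact Finset.eq_empty_of_forall_notMem fun v hv => absurd (h.bound v hv) (Nat.not_lt_zero _)
  · rintro rfl
    constructor <;> simp

theorem Exponent.star_ne_one : Exponent.star ≠ Exponent.one := by
  intro h; cases h

/-- A right end carries the letter `1`, so the last point belongs to no pair. Diagrams record pairs
only, and the new singleton shows up just in `openPoints`. -/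
theorem diagrams_succ_of_star (h : ε n = .star) : diagrams ε (n + 1) = diagrams ε n := by
  ext P
  rw [mem_diagrams, mem_diagrams]
  constructor
  · intro hP
    refine { hP with bound := fun v hv => ?_, cover := fun i hi => hP.cover i (by omega) }
    have h1 := hP.bound v hv
    have h2 : v.2 ≠ n := by
      intro h'
      have := hP.one v hv
      rw [h', h] at this
      exact Exponent.star_ne_one this
    omega
  · intro hP
    refine { hP with bound := fun v hv => (hP.bound v hv).trans (Nat.lt_succ_self n),
                     cover := fun i hi h' => ?_ }
    rcases Nat.lt_succ_iff_lt_or_eq.1 hi with hi | rfl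
    · exact hP.cover i hi h'
    · rw [h] at h'; exact absurd h' Exponent.star_ne_one

theorem IsDiagram.notMem (hP : IsDiagram ε n P) (k : ℕ) : (k, n) ∉ P := fun h =>
  lt_irrefl _ (hP.bound _ h)

theorem IsDiagram.star_of_mem_openPoints (hP : IsDiagram ε n P) {k : ℕ}
    (hk : k ∈ openPoints n P) : ε k = .star := by
  rw [mem_openPoints] at hk
  cases h : ε k with
  | star => rfl
  | one =>
    obtain ⟨v, hv, hvk⟩ := hP.cover k hk.1 h
    exact absurd hvk.symm (hk.2 v hv).2

theorem IsDiagram.insert (hP : IsDiagram ε n P) (h : ε n = .one) {k : ℕ}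
    (hk : k ∈ openPoints n P) : IsDiagram ε (n + 1) (insert (k, n) P) := by
  have hs := hP.star_of_mem_openPoints hk
  rw [mem_openPoints] at hk
  constructor
  · simpa [Finset.forall_mem_insert] using ⟨hk.1, fun a b hab => hP.lt _ hab⟩
  · intro v hv
    rcases Finset.mem_insert.1 hv with rfl | hv
    · exact Nat.lt_succ_self n
    · exact (hP.bound v hv).trans (Nat.lt_succ_self n)
  · intro v hv
    rcases Finset.mem_insert.1 hv with rfl | hv
    · exact hs
    · exact hP.star v hv
  · intro v hv
    rcases Finset.mem_insert.1 hv with rfl | hv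
    · exact h
    · exact hP.one v hv
  · intro v hv w hw hvw
    rcases Finset.mem_insert.1 hv with rfl | hv <;> rcases Finset.mem_insert.1 hw with rfl | hw
    · rfl
    · exact absurd hvw (hk.2 w hw).1
    · exact absurd hvw.symm (hk.2 v hv).1
    · exact hP.inj₁ v hv w hw hvw
  · intro v hv w hw hvw
    rcases Finset.mem_insert.1 hv with rfl | hv <;> rcases Finset.mem_insert.1 hw with rfl | hw
    · rfl
    · exact absurd hvw (hP.bound w hw).ne'
    · exact absurd hvw (hP.bound v hv).ne
    · exact hP.inj₂ v hv w hw hvw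
  · intro i hi h'
    rcases Nat.lt_succ_iff_lt_or_eq.1 hi with hi | rfl
    · obtain ⟨v, hv, hvi⟩ := hP.cover i hi h'
      exact ⟨v, Finset.mem_insert_of_mem hv, hvi⟩
    · exact ⟨(k, i), Finset.mem_insert_self _ _, rfl⟩

theorem IsDiagram.erase {k : ℕ} (hP : IsDiagram ε (n + 1) P) (hk : (k, n) ∈ P) :
    IsDiagram ε n (P.erase (k, n)) ∧ k ∈ openPoints n (P.erase (k, n)) := by
  have hsub : ∀ v ∈ P.erase (k, n), v ∈ P := fun v hv => Finset.mem_of_mem_erase hv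
  have hb : ∀ v ∈ P.erase (k, n), v.2 < n := by
    intro v hv
    have h1 := hP.bound v (hsub v hv)
    have h2 : v.2 ≠ n := fun h =>
      (Finset.mem_erase.1 hv).1 (hP.inj₂ v (hsub v hv) _ hk h)
    omega
  refine ⟨⟨fun v hv => hP.lt v (hsub v hv), hb, fun v hv => hP.star v (hsub v hv),
    fun v hv => hP.one v (hsub v hv), fun v hv w hw => hP.inj₁ v (hsub v hv) w (hsub w hw),
    fun v hv w hw => hP.inj₂ v (hsub v hv) w (hsub w hw), ?_⟩, ?_⟩
  · intro i hi h
    obtain ⟨v, hv, hvi⟩ := hP.cover i (by omega) h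
    refine ⟨v, Finset.mem_erase.2 ⟨?_, hv⟩, hvi⟩
    rintro rfl
    exact hi.ne hvi.symm
  · rw [mem_openPoints]
    refine ⟨hP.lt _ hk, fun v hv => ⟨fun h => ?_, fun h => ?_⟩⟩
    · exact (Finset.mem_erase.1 hv).1 (hP.inj₁ v (hsub v hv) _ hk h.symm)
    · have h1 := hP.star _ hk
      have h2 := hP.one v (hsub v hv)
      rw [← h] at h2
      exact Exponent.star_ne_one (h1.symm.trans h2)

/-- A last point with letter `1` must be the right end of a pair. Erasing this pair leaves a diagram
on `n` points in which its left end is open, and this can be undone. -/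
theorem sum_diagrams_succ_of_one {M : Type*} [AddCommMonoid M] (h : ε n = .one)
    (F : Finset (ℕ × ℕ) → M) :
    ∑ P ∈ diagrams ε (n + 1), F P =
      ∑ P ∈ diagrams ε n, ∑ k ∈ openPoints n P, F (insert (k, n) P) := by
  rw [Finset.sum_sigma']
  symm
  refine Finset.sum_bij (fun a _ => insert (a.2, n) a.1) ?_ ?_ ?_ ?_
  · rintro ⟨P, k⟩ ha
    rw [Finset.mem_sigma, mem_diagrams] at ha
    exact mem_diagrams.2 (ha.1.insert h ha.2)
  · rintro ⟨P, k⟩ ha ⟨Q, l⟩ hb hab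
    rw [Finset.mem_sigma, mem_diagrams] at ha hb
    replace ha : IsDiagram ε n P ∧ k ∈ openPoints n P := ha
    replace hb : IsDiagram ε n Q ∧ l ∈ openPoints n Q := hb
    change insert (k, n) P = insert (l, n) Q at hab
    have hkl : k = l := by
      have : (k, n) ∈ insert (l, n) Q := hab ▸ Finset.mem_insert_self _ _
      rcases Finset.mem_insert.1 this with h | h
      · exact congrArg Prod.fst h
      · exact absurd h (hb.1.notMem k)
    subst hkl
    have : P = Q := by
      rw [← Finset.erase_insert (ha.1.notMem k), hab, Finset.erase_insert (hb.1.notMem k)]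
    rw [this]
  · intro Q hQ
    rw [mem_diagrams] at hQ
    obtain ⟨⟨k, m⟩, hv, hm⟩ := hQ.cover n (Nat.lt_succ_self n) h
    change m = n at hm
    subst hm
    obtain ⟨h1, h2⟩ := hQ.erase hv
    exact ⟨⟨Q.erase (k, m), k⟩, Finset.mem_sigma.2 ⟨mem_diagrams.2 h1, h2⟩,
      Finset.insert_erase hv⟩
  · intro a _; rfl

/-- The number of crossings. -/
def diagramCrossings (P : Finset (ℕ × ℕ)) : ℕ :=
  ∑ v ∈ P, ∑ w ∈ P, if v.1 < w.1 ∧ w.1 < v.2 ∧ v.2 < w.2 then 1 else 0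

/-- The number of pairs of an open point and a covering pair. -/
def diagramInner (n : ℕ) (P : Finset (ℕ × ℕ)) : ℕ :=
  ∑ c ∈ openPoints n P, ∑ w ∈ P, if w.1 < c ∧ c < w.2 then 1 else 0

/-- The number of pairs covering `v`. -/
def diagramCover (P : Finset (ℕ × ℕ)) (v : ℕ × ℕ) : ℕ :=
  ∑ w ∈ P, if w.1 < v.1 ∧ v.2 < w.2 then 1 else 0

/-- The number of open points to the left of `v`. -/
def diagramLeft (n : ℕ) (P : Finset (ℕ × ℕ)) (v : ℕ × ℕ) : ℕ :=
  ∑ c ∈ openPoints n P, if c < v.1 then 1 else 0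

theorem openPoints_succ (hP : IsDiagram ε n P) :
    openPoints (n + 1) P = insert n (openPoints n P) := by
  ext i
  rw [Finset.mem_insert, mem_openPoints, mem_openPoints, Nat.lt_succ_iff_lt_or_eq]
  constructor
  · rintro ⟨h | h, h'⟩
    · exact Or.inr ⟨h, h'⟩
    · exact Or.inl h
  · rintro (rfl | ⟨h, h'⟩)
    · refine ⟨Or.inr rfl, fun v hv => ?_⟩
      have h1 := hP.bound v hv
      have h2 := hP.lt v hv
      omega
    · exact ⟨Or.inl h, h'⟩

theorem notMem_openPoints (n : ℕ) (P : Finset (ℕ × ℕ)) : n ∉ openPoints n P := fun h =>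
  lt_irrefl _ (mem_openPoints.1 h).1

theorem diagramInner_succ (hP : IsDiagram ε n P) : diagramInner (n + 1) P = diagramInner n P := by
  rw [diagramInner, openPoints_succ hP, Finset.sum_insert (notMem_openPoints n P),
    Finset.sum_eq_zero, zero_add, diagramInner]
  intro w hw
  have := hP.bound w hw
  rw [if_neg (by omega)]

theorem diagramLeft_succ (hP : IsDiagram ε n P) {v : ℕ × ℕ} (hv : v ∈ P) :
    diagramLeft (n + 1) P v = diagramLeft n P v := by
  have h1 := hP.bound v hv
  have h2 := hP.lt v hv
  rw [diagramLeft, openPoints_succ hP, Finset.sum_insert (notMem_openPoints n P),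
    if_neg (by omega), zero_add, diagramLeft]

theorem openPoints_insert (n k : ℕ) (P : Finset (ℕ × ℕ)) :
    openPoints (n + 1) (insert (k, n) P) = (openPoints n P).erase k := by
  ext i
  rw [Finset.mem_erase, mem_openPoints, mem_openPoints, Finset.forall_mem_insert]
  constructor
  · rintro ⟨h, ⟨h1, h2⟩, h3⟩
    exact ⟨h1, lt_of_le_of_ne (Nat.lt_succ_iff.1 h) h2, h3⟩
  · rintro ⟨h1, h2, h3⟩
    exact ⟨h2.trans (Nat.lt_succ_self n), ⟨h1, h2.ne⟩, h3⟩

/-- The new pair ends to the right of all others, so it crosses exactly the old pairs that have `k`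
strictly inside. -/
theorem diagramCrossings_insert (hP : IsDiagram ε n P) (k : ℕ) :
    diagramCrossings (insert (k, n) P) =
      diagramCrossings P + ∑ v ∈ P, if v.1 < k ∧ k < v.2 then 1 else 0 := by
  unfold diagramCrossings
  rw [Finset.sum_insert (hP.notMem k), Finset.sum_insert (hP.notMem k), if_neg (by simp), zero_add,
    Finset.sum_eq_zero, zero_add, add_comm, ← Finset.sum_add_distrib]
  · refine Finset.sum_congr rfl fun v hv => ?_
    have := hP.bound v hv
    rw [Finset.sum_insert (hP.notMem k)]
    congr 1
    simp [this]
  · intro w hw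
    have := hP.bound w hw
    rw [if_neg (by simp; omega)]

/-- The point `k` stops being a singleton, and the open points to its right come under the new pair.
The incidences lost with `k` are precisely the crossings gained in `diagramCrossings_insert`, so
they cancel in `Cr + InS`. -/
theorem diagramInner_insert (hP : IsDiagram ε n P) {k : ℕ} (hk : k ∈ openPoints n P) :
    diagramInner (n + 1) (insert (k, n) P) + ∑ v ∈ P, (if v.1 < k ∧ k < v.2 then 1 else 0) =
      diagramInner n P + ((openPoints n P).filter (k < ·)).card := by
  have h1 : ((openPoints n P).filter (k < ·)).card =
      ∑ c ∈ (openPoints n P).erase k, if k < c ∧ c < n then 1 else 0 := by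
    rw [Finset.card_filter, ← Finset.add_sum_erase _ _ hk, if_neg (lt_irrefl k), zero_add]
    refine Finset.sum_congr rfl fun c hc => ?_
    have := (mem_openPoints.1 (Finset.mem_of_mem_erase hc)).1
    simp [this]
  rw [h1, diagramInner, diagramInner, openPoints_insert,
    ← Finset.add_sum_erase (openPoints n P) _ hk]
  simp only [Finset.sum_insert (hP.notMem k), Finset.sum_add_distrib]
  ring

/-- The gain here is the loss in `diagramLeft_insert`, so the sum of the two statistics of an old
pair is preserved. -/
theorem diagramCover_insert (hP : IsDiagram ε n P) (k : ℕ) {v : ℕ × ℕ} (hv : v ∈ P) :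
    diagramCover (insert (k, n) P) v = diagramCover P v + if k < v.1 then 1 else 0 := by
  have := hP.bound v hv
  rw [diagramCover, Finset.sum_insert (hP.notMem k), add_comm, diagramCover]
  simp [this]

theorem diagramLeft_insert {k : ℕ} (hk : k ∈ openPoints n P) (v : ℕ × ℕ) :
    diagramLeft (n + 1) (insert (k, n) P) v + (if k < v.1 then 1 else 0) = diagramLeft n P v := by
  rw [diagramLeft, openPoints_insert, Finset.sum_erase_add _ _ hk, diagramLeft]

theorem diagramCover_insert_self (hP : IsDiagram ε n P) (k : ℕ) :
    diagramCover (insert (k, n) P) (k, n) = 0 := by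
  refine Finset.sum_eq_zero fun w hw => if_neg ?_
  rcases Finset.mem_insert.1 hw with rfl | hw
  · simp
  · have := hP.bound w hw
    simp; omega

theorem diagramLeft_insert_self {k : ℕ} (hk : k ∈ openPoints n P) :
    diagramLeft (n + 1) (insert (k, n) P) (k, n) = ((openPoints n P).filter (· < k)).card := by
  have := diagramLeft_insert hk (k, n)
  rw [if_neg (lt_irrefl k), add_zero] at this
  rw [this, diagramLeft, Finset.card_filter]

end Diagrams

/-! ### The Wick formula over diagrams, by induction on the length of the word. -/

section Wick

variable {H : Type*} [NormedAddCommGroup H] [InnerProductSpace ℂ H]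

/-- The tensor product of the `x i`, `i ∈ S`, in increasing order. -/
def tensorOn (x : ℕ → H) (S : Finset ℕ) : Fock H :=
  pureTensor (fun k : Fin S.card => x (S.orderEmbOfFin rfl k))

theorem tensorOn_eq (x : ℕ → H) {S : Finset ℕ} {m : ℕ} (h : S.card = m) :
    tensorOn x S = pureTensor (fun k : Fin m => x (S.orderEmbOfFin h k)) := by
  subst h; rfl

theorem creation_tensorOn (x : ℕ → H) {S : Finset ℕ} {n : ℕ} (hS : ∀ i ∈ S, i < n) :
    creation (x n) (tensorOn x S) = tensorOn x (insert n S) := by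
  have hn : n ∉ S := fun h => lt_irrefl _ (hS n h)
  have hc : (insert n S).card = S.card + 1 := Finset.card_insert_of_notMem hn
  have hmono : StrictMono (Fin.snoc (S.orderEmbOfFin rfl) n : Fin (S.card + 1) → ℕ) := by
    intro i j hij
    induction j using Fin.lastCases with
    | last =>
      induction i using Fin.lastCases with
      | last => exact absurd hij (lt_irrefl _)
      | cast i => simpa using hS _ (S.orderEmbOfFin_mem rfl i)
    | cast j =>
      induction i using Fin.lastCases with
      | last => exact absurd hij (Fin.castSucc_lt_last j).not_gt
      | cast i => simpa using hij
  have hmem : ∀ k, (Fin.snoc (S.orderEmbOfFin rfl) n : Fin (S.card + 1) → ℕ) k ∈ insert n S := by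
    intro k
    induction k using Fin.lastCases with
    | last => simp
    | cast k => simp
  have huniq := Finset.orderEmbOfFin_unique hc hmem hmono
  rw [tensorOn_eq x hc, ← huniq, tensorOn, creation_pureTensor]
  congr 1
  ext1 k
  induction k using Fin.lastCases with
  | last => simp
  | cast k => simp

theorem orderEmbOfFin_erase {S : Finset ℕ} {m : ℕ} (h : S.card = m + 1) (k : Fin (m + 1))
    (h' : (S.erase (S.orderEmbOfFin h k)).card = m) (i : Fin m) :
    (S.erase (S.orderEmbOfFin h k)).orderEmbOfFin h' i = S.orderEmbOfFin h (k.succAbove i) := by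
  have := Finset.orderEmbOfFin_unique h' (f := fun i => S.orderEmbOfFin h (k.succAbove i))
    (fun i => Finset.mem_erase.2 ⟨by simp, S.orderEmbOfFin_mem h _⟩)
    (fun i j hij => by simpa using hij)
  exact (congrFun this i).symm

theorem card_filter_lt_orderEmbOfFin {S : Finset ℕ} {m : ℕ} (h : S.card = m + 1)
    (k : Fin (m + 1)) : (S.filter (S.orderEmbOfFin h k < ·)).card = m - k.val ∧
      (S.filter (· < S.orderEmbOfFin h k)).card = k.val := by
  have h1 : ∀ p : ℕ → Prop, ∀ [DecidablePred p], (S.filter p).card =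
      (Finset.univ.filter fun i => p (S.orderEmbOfFin h i)).card := by
    intro p _
    conv_lhs => rw [← Finset.map_orderEmbOfFin_univ S h, Finset.filter_map, Finset.card_map]
    rfl
  rw [h1, h1]
  simp only [OrderEmbedding.lt_iff_lt]
  constructor
  · have := Fin.card_Ioi k
    rw [← Finset.filter_lt_eq_Ioi] at this
    omega
  · have := Fin.card_Iio k
    rwa [← Finset.filter_gt_eq_Iio] at this

/-- In a set of `m + 1` points, the element of index `k` has `m - k` points above it and `k` below.
Writing `m + k = (m - k) + 2 k` expresses the coefficients of `annihForm` by these two counts. -/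
theorem annihOp_tensorOn (J : H →ₗ[ℂ] H) (α q : ℝ) (y : H) (x : ℕ → H) (S : Finset ℕ) :
    annihOp J α q y (tensorOn x S) = ∑ c ∈ S,
      ((q : ℂ) ^ (S.filter (c < ·)).card * (⟪y, x c⟫_ℂ +
        (α : ℂ) * (q : ℂ) ^ (2 * (S.filter (· < c)).card) * ⟪y, J (x c)⟫_ℂ)) •
      tensorOn x (S.erase c) := by
  rcases h : S.card with _ | m
  · rw [Finset.card_eq_zero] at h
    subst h
    rw [Finset.sum_empty, tensorOn_eq x Finset.card_empty, pureTensor, annihOp_lof_zero]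
  · rw [tensorOn_eq x h, pureTensor, annihOp_lof_succ, annihTensor_tprod, map_sum,
      ← Finset.sum_coe_sort S, ← Equiv.sum_comp (S.orderIsoOfFin h).toEquiv]
    refine Finset.sum_congr rfl fun k _ => ?_
    change _ = ((q : ℂ) ^ (S.filter (S.orderEmbOfFin h k < ·)).card *
      (⟪y, x (S.orderEmbOfFin h k)⟫_ℂ + (α : ℂ) *
        (q : ℂ) ^ (2 * (S.filter (· < S.orderEmbOfFin h k)).card) *
          ⟪y, J (x (S.orderEmbOfFin h k))⟫_ℂ)) • tensorOn x (S.erase (S.orderEmbOfFin h k))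
    have h' : (S.erase (S.orderEmbOfFin h k)).card = m := by
      rw [Finset.card_erase_of_mem (S.orderEmbOfFin_mem h k), h]; rfl
    obtain ⟨h1, h2⟩ := card_filter_lt_orderEmbOfFin h k
    rw [h1, h2, tensorOn_eq x h', map_smul, annihForm_apply]
    simp only [orderEmbOfFin_erase]
    have h3 : m + k.val = (m - k.val) + 2 * k.val := by have := k.isLt; omega
    rw [h3, pow_add, pureTensor]
    congr 1
    ring

theorem fockWord_succ (J : H →ₗ[ℂ] H) (α q : ℝ) {n : ℕ} (ε : Fin (n + 1) → Exponent)
    (x : Fin (n + 1) → H) : fockWord J α q ε x = fockOp J α q (ε (Fin.last n)) (x (Fin.last n)) *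
      fockWord J α q (fun i => ε i.castSucc) (fun i => x i.castSucc) := by
  rw [fockWord, List.ofFn_succ', List.concat_eq_append, List.reverse_append, List.prod_append,
    List.reverse_singleton, List.prod_singleton]
  rfl

/-- The coefficient of a diagram in the Wick formula. -/
def diagramWeight (J : H →ₗ[ℂ] H) (α q : ℝ) (x : ℕ → H) (n : ℕ) (P : Finset (ℕ × ℕ)) : ℂ :=
  (q : ℂ) ^ (diagramCrossings P + diagramInner n P) *
    ∏ v ∈ P, (⟪x v.2, x v.1⟫_ℂ +
      (α : ℂ) * (q : ℂ) ^ (2 * diagramCover P v + 2 * diagramLeft n P v) * ⟪x v.2, J (x v.1)⟫_ℂ)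

theorem diagramWeight_succ (J : H →ₗ[ℂ] H) (α q : ℝ) (x : ℕ → H) {ε : ℕ → Exponent} {n : ℕ}
    {P : Finset (ℕ × ℕ)} (hP : IsDiagram ε n P) :
    diagramWeight J α q x (n + 1) P = diagramWeight J α q x n P := by
  unfold diagramWeight
  rw [diagramInner_succ hP]
  congr 1
  refine Finset.prod_congr rfl fun v hv => ?_
  rw [diagramLeft_succ hP hv]

/-- The heart of the induction: the weight changes by exactly the coefficient in `annihOp_tensorOn`.
`Cr + InS` grows by the number of open points right of `k`, the factors of the old pairs stay the
same, and the new pair is uncovered. -/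
theorem diagramWeight_insert (J : H →ₗ[ℂ] H) (α q : ℝ) (x : ℕ → H) {ε : ℕ → Exponent} {n : ℕ}
    {P : Finset (ℕ × ℕ)} (hP : IsDiagram ε n P) {k : ℕ} (hk : k ∈ openPoints n P) :
    diagramWeight J α q x (n + 1) (insert (k, n) P) = diagramWeight J α q x n P *
      ((q : ℂ) ^ ((openPoints n P).filter (k < ·)).card * (⟪x n, x k⟫_ℂ +
        (α : ℂ) * (q : ℂ) ^ (2 * ((openPoints n P).filter (· < k)).card) * ⟪x n, J (x k)⟫_ℂ)) := by
  unfold diagramWeight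
  rw [Finset.prod_insert (hP.notMem k), diagramCover_insert_self hP, diagramLeft_insert_self hk]
  have h1 : diagramCrossings (insert (k, n) P) + diagramInner (n + 1) (insert (k, n) P) =
      diagramCrossings P + diagramInner n P + ((openPoints n P).filter (k < ·)).card := by
    have := diagramInner_insert hP hk
    rw [diagramCrossings_insert hP k]
    omega
  have h2 : ∀ v ∈ P, 2 * diagramCover (insert (k, n) P) v +
      2 * diagramLeft (n + 1) (insert (k, n) P) v =
      2 * diagramCover P v + 2 * diagramLeft n P v := by
    intro v hv
    have := diagramLeft_insert hk v
    rw [diagramCover_insert hP k hv]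
    omega
  rw [h1, Finset.prod_congr rfl fun v hv => by rw [h2 v hv], pow_add]
  simp only [mul_zero, zero_add]
  ring

/-- The Wick formula as a sum over diagrams. -/
theorem fockWord_vacuum_eq_sum_diagrams {J : H →ₗ[ℂ] H} (hJ : Function.Involutive J) {α q : ℝ}
    (hα : α ∈ Set.Ioo (-1 : ℝ) 1) (hq : q ∈ Set.Ioo (-1 : ℝ) 1) (x : ℕ → H) (ε : ℕ → Exponent)
    (n : ℕ) : fockWord J α q (fun i : Fin n => ε i) (fun i : Fin n => x i) vacuum =
      ∑ P ∈ diagrams ε n, diagramWeight J α q x n P • tensorOn x (openPoints n P) := by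
  induction n with
  | zero =>
    rw [diagrams_zero, Finset.sum_singleton]
    have h1 : diagramWeight J α q x 0 ∅ = 1 := by
      simp [diagramWeight, diagramCrossings, diagramInner]
    rw [h1, one_smul, show openPoints 0 ∅ = ∅ from rfl, tensorOn_eq x Finset.card_empty]
    simp only [fockWord, List.ofFn_zero, List.reverse_nil, List.prod_nil, Module.End.one_apply,
      vacuum]
    congr 1
    exact Subsingleton.elim _ _
  | succ n ih =>
    rw [fockWord_succ, Module.End.mul_apply]
    simp only [Fin.val_castSucc, Fin.val_last]
    rw [ih, map_sum]
    cases h : ε n with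
    | star =>
      rw [diagrams_succ_of_star h]
      refine Finset.sum_congr rfl fun P hP => ?_
      rw [mem_diagrams] at hP
      rw [map_smul, fockOp, creation_tensorOn x fun i hi => (mem_openPoints.1 hi).1,
        diagramWeight_succ J α q x hP, openPoints_succ hP]
    | one =>
      rw [sum_diagrams_succ_of_one h]
      refine Finset.sum_congr rfl fun P hP => ?_
      rw [mem_diagrams] at hP
      rw [map_smul, fockOp, annihilation_eq hJ hα hq, annihOp_tensorOn, Finset.smul_sum]
      refine Finset.sum_congr rfl fun k hk => ?_
      rw [smul_smul, diagramWeight_insert J α q x hP hk, openPoints_insert]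

end Wick

/-! ### Set partitions and diagrams -/

section Partitions

variable {n : ℕ} {π : SetPartition n}

theorem lo_mem (V : Block π) : lo V ∈ V.1 := Finset.min'_mem _ _

theorem hi_mem (V : Block π) : hi V ∈ V.1 := Finset.max'_mem _ _

theorem lo_le (V : Block π) {i : Fin n} (h : i ∈ V.1) : lo V ≤ i := Finset.min'_le _ _ h

theorem le_hi (V : Block π) {i : Fin n} (h : i ∈ V.1) : i ≤ hi V := Finset.le_max' _ _ h

theorem block_eq_of_mem {V W : Block π} {i : Fin n} (hV : i ∈ V.1) (hW : i ∈ W.1) : V = W :=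
  Subtype.ext (π.eq_of_mem_parts V.2 W.2 hV hW)

theorem exists_mem_block (π : SetPartition n) (i : Fin n) : ∃ V : Block π, i ∈ V.1 := by
  obtain ⟨V, hV, hi⟩ := π.exists_mem (Finset.mem_univ i)
  exact ⟨⟨V, hV⟩, hi⟩

theorem IsSingleton.eq {V : Block π} (h : IsSingleton V) : V.1 = {lo V} := by
  obtain ⟨a, ha⟩ := Finset.card_eq_one.1 h
  have := lo_mem V
  rw [ha, Finset.mem_singleton] at this
  rw [ha, this]

theorem IsSingleton.hi_eq {V : Block π} (h : IsSingleton V) : hi V = lo V := by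
  have := hi_mem V
  rwa [h.eq, Finset.mem_singleton] at this

theorem IsPair.lo_lt_hi {V : Block π} (h : IsPair V) : lo V < hi V :=
  Finset.min'_lt_max'_of_card _ (by rw [h]; exact one_lt_two)

theorem IsPair.eq {V : Block π} (h : IsPair V) : V.1 = {lo V, hi V} := by
  symm
  apply Finset.eq_of_subset_of_card_le
  · intro i hi'
    rcases Finset.mem_insert.1 hi' with rfl | hi'
    · exact lo_mem V
    · rw [Finset.mem_singleton.1 hi']; exact hi_mem V
  · rw [h, Finset.card_pair h.lo_lt_hi.ne]

theorem IsPair.not_isSingleton {V : Block π} (h : IsPair V) : ¬IsSingleton V := fun h' => by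
  unfold IsPair at h; unfold IsSingleton at h'; omega

theorem mem_pairs {V : Block π} : V ∈ pairs π ↔ IsPair V := by
  simp [pairs]

open Classical in
/-- The singleton blocks. -/
def singletonBlocks (π : SetPartition n) : Finset (Block π) := {V | IsSingleton V}

theorem mem_singletonBlocks {V : Block π} : V ∈ singletonBlocks π ↔ IsSingleton V := by
  simp [singletonBlocks]

theorem mem_singletons {i : Fin n} : i ∈ singletons π ↔ {i} ∈ π.parts := by
  simp [singletons]

/-- The endpoints of a block, as natural numbers. -/
def endpoints (π : SetPartition n) : Block π ↪ ℕ × ℕ where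
  toFun V := (lo V, hi V)
  inj' V W h := block_eq_of_mem (lo_mem V)
    ((Fin.ext (congrArg Prod.fst h) : lo V = lo W) ▸ lo_mem W)

/-- The smallest element of a block, as a natural number. -/
def loNat (π : SetPartition n) : Block π ↪ ℕ where
  toFun V := lo V
  inj' V W h := block_eq_of_mem (lo_mem V) ((Fin.ext h : lo V = lo W) ▸ lo_mem W)

/-- The diagram of a partition. -/
def diagram (π : SetPartition n) : Finset (ℕ × ℕ) := (pairs π).map (endpoints π)

theorem mem_diagram {v : ℕ × ℕ} :
    v ∈ diagram π ↔ ∃ V : Block π, IsPair V ∧ ((lo V : ℕ), (hi V : ℕ)) = v := by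
  rw [diagram, Finset.mem_map]
  simp only [mem_pairs]
  rfl

variable {ε : Fin n → Exponent}

theorem mem_partitions : π ∈ partitions ε ↔ IsCompatible ε π := by
  simp [partitions]

theorem IsCompatible.isPair_or (h : IsCompatible ε π) (V : Block π) :
    IsPair V ∨ IsSingleton V :=
  (h V).imp And.left And.left

/-- With this, the existential definitions of covering and crossing become inequalities between `lo`
and `hi`. -/
theorem IsCompatible.isPair_of_ne (h : IsCompatible ε π) {V : Block π} {i j : Fin n}
    (hi' : i ∈ V.1) (hj : j ∈ V.1) (hij : i < j) : IsPair V ∧ i = lo V ∧ j = hi V := by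
  have hp : IsPair V := by
    refine (h.isPair_or V).resolve_right fun hs => ?_
    rw [hs.eq, Finset.mem_singleton] at hi' hj
    exact hij.ne (hi'.trans hj.symm)
  refine ⟨hp, ?_⟩
  rw [hp.eq, Finset.mem_insert, Finset.mem_singleton] at hi' hj
  have := hp.lo_lt_hi
  rcases hi' with rfl | rfl <;> rcases hj with rfl | rfl
  · exact absurd hij (lt_irrefl _)
  · exact ⟨rfl, rfl⟩
  · exact absurd hij this.not_gt
  · exact absurd hij (lt_irrefl _)

theorem openPoints_diagram (h : IsCompatible ε π) :
    openPoints n (diagram π) = (singletonBlocks π).map (loNat π) := by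
  ext i
  rw [mem_openPoints, Finset.mem_map]
  constructor
  · rintro ⟨hi', h'⟩
    obtain ⟨V, hV⟩ := exists_mem_block π ⟨i, hi'⟩
    have hs : IsSingleton V := by
      refine (h.isPair_or V).resolve_left fun hp => ?_
      obtain ⟨h1, h2⟩ := h' _ (mem_diagram.2 ⟨V, hp, rfl⟩)
      rw [hp.eq, Finset.mem_insert, Finset.mem_singleton, Fin.ext_iff, Fin.ext_iff] at hV
      exact hV.elim h1 h2
    refine ⟨V, mem_singletonBlocks.2 hs, ?_⟩
    rw [hs.eq, Finset.mem_singleton, Fin.ext_iff] at hV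
    exact hV.symm
  · rintro ⟨V, hV, rfl⟩
    rw [mem_singletonBlocks] at hV
    refine ⟨(lo V).isLt, fun v hv => ?_⟩
    obtain ⟨W, hW, rfl⟩ := mem_diagram.1 hv
    refine ⟨fun h' => ?_, fun h' => ?_⟩
    · have h2 : lo V = lo W := Fin.ext h'
      have := block_eq_of_mem (h2 ▸ lo_mem V) (lo_mem W)
      exact hW.not_isSingleton (this ▸ hV)
    · have h2 : lo V = hi W := Fin.ext h'
      have := block_eq_of_mem (h2 ▸ lo_mem V) (hi_mem W)
      exact hW.not_isSingleton (this ▸ hV)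

theorem singletons_eq_image (π : SetPartition n) :
    (singletons π).map Fin.valEmbedding = (singletonBlocks π).map (loNat π) := by
  ext i
  rw [Finset.mem_map, Finset.mem_map]
  constructor
  · rintro ⟨i, hi', rfl⟩
    rw [mem_singletons] at hi'
    let V : Block π := ⟨{i}, hi'⟩
    refine ⟨V, mem_singletonBlocks.2 (Finset.card_singleton i), ?_⟩
    exact congrArg Fin.val (Finset.mem_singleton.1 (lo_mem V))
  · rintro ⟨V, hV, rfl⟩
    rw [mem_singletonBlocks] at hV
    exact ⟨lo V, mem_singletons.2 (hV.eq ▸ V.2), rfl⟩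

theorem isDiagram_diagram (h : IsCompatible ε π) {E : ℕ → Exponent} (hE : ∀ i : Fin n, E i = ε i) :
    IsDiagram E n (diagram π) := by
  have hc : ∀ V : Block π, IsPair V → ε (lo V) = .star ∧ ε (hi V) = .one := fun V hV =>
    (h V).elim And.right fun h' => absurd h'.1 hV.not_isSingleton
  constructor
  · intro v hv
    obtain ⟨V, hV, rfl⟩ := mem_diagram.1 hv
    exact hV.lo_lt_hi
  · intro v hv
    obtain ⟨V, hV, rfl⟩ := mem_diagram.1 hv
    exact (hi V).isLt
  · intro v hv
    obtain ⟨V, hV, rfl⟩ := mem_diagram.1 hv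
    rw [hE]; exact (hc V hV).1
  · intro v hv
    obtain ⟨V, hV, rfl⟩ := mem_diagram.1 hv
    rw [hE]; exact (hc V hV).2
  · intro v hv w hw hvw
    obtain ⟨V, hV, rfl⟩ := mem_diagram.1 hv
    obtain ⟨W, hW, rfl⟩ := mem_diagram.1 hw
    have h2 : lo V = lo W := Fin.ext hvw
    have h3 : V = W := block_eq_of_mem (h2 ▸ lo_mem V) (lo_mem W)
    rw [h3]
  · intro v hv w hw hvw
    obtain ⟨V, hV, rfl⟩ := mem_diagram.1 hv
    obtain ⟨W, hW, rfl⟩ := mem_diagram.1 hw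
    have h2 : hi V = hi W := Fin.ext hvw
    have h3 : V = W := block_eq_of_mem (h2 ▸ hi_mem V) (hi_mem W)
    rw [h3]
  · intro i hi' h1
    obtain ⟨V, hV⟩ := exists_mem_block π ⟨i, hi'⟩
    have h2 : ε ⟨i, hi'⟩ = .one := by rw [← hE, h1]
    rcases h V with ⟨hp, hs, -⟩ | ⟨hp, hs⟩
    · refine ⟨_, mem_diagram.2 ⟨V, hp, rfl⟩, ?_⟩
      rw [hp.eq, Finset.mem_insert, Finset.mem_singleton] at hV
      rcases hV with hV | hV
      · rw [hV, hs] at h2; exact absurd h2 Exponent.star_ne_one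
      · exact congrArg Fin.val hV.symm
    · rw [hp.eq, Finset.mem_singleton] at hV
      rw [hV, hs] at h2; exact absurd h2 Exponent.star_ne_one

/-- The diagram determines every block: pairs are its elements, singletons its open points. -/
theorem parts_subset_of_diagram_eq {π' : SetPartition n} (h : IsCompatible ε π)
    (h' : IsCompatible ε π') (hd : diagram π = diagram π') : π.parts ⊆ π'.parts := by
  intro V hV
  rcases h.isPair_or ⟨V, hV⟩ with hp | hs
  · obtain ⟨W, hW, hWV⟩ := mem_diagram.1 (hd ▸ mem_diagram.2 ⟨⟨V, hV⟩, hp, rfl⟩)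
    have h1 : lo W = lo ⟨V, hV⟩ := Fin.ext (congrArg Prod.fst hWV)
    have h2 : hi W = hi ⟨V, hV⟩ := Fin.ext (congrArg Prod.snd hWV)
    have h3 : V = W.1 := by rw [hW.eq, h1, h2]; exact hp.eq
    rw [h3]; exact W.2
  · have h1 : (lo ⟨V, hV⟩ : ℕ) ∈ openPoints n (diagram π) := by
      rw [openPoints_diagram h]
      exact Finset.mem_map_of_mem (loNat π) (mem_singletonBlocks.2 hs)
    rw [hd, openPoints_diagram h', Finset.mem_map] at h1
    obtain ⟨W, hW, hWV⟩ := h1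
    rw [mem_singletonBlocks] at hW
    have h2 : lo W = lo ⟨V, hV⟩ := Fin.ext hWV
    have h3 : V = W.1 := by rw [hW.eq, h2]; exact hs.eq
    rw [h3]; exact W.2

/-- Left ends carry `∗` and right ends carry `1`, so no point can be a left end of one pair and a
right end of another. -/
theorem IsDiagram.eq_of_endpoint {E : ℕ → Exponent} {P : Finset (ℕ × ℕ)} (hP : IsDiagram E n P)
    {v w : ℕ × ℕ} (hv : v ∈ P) (hw : w ∈ P) {i : ℕ} (h : i = v.1 ∨ i = v.2)
    (h' : i = w.1 ∨ i = w.2) : v = w := by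
  rcases h with h | h <;> rcases h' with h' | h'
  · exact hP.inj₁ v hv w hw (h.symm.trans h')
  · have h1 := hP.star v hv
    have h2 := hP.one w hw
    rw [← h, h', h2] at h1
    exact absurd h1.symm Exponent.star_ne_one
  · have h1 := hP.one v hv
    have h2 := hP.star w hw
    rw [← h, h', h2] at h1
    exact absurd h1 Exponent.star_ne_one
  · exact hP.inj₂ v hv w hw (h.symm.trans h')

/-- The blocks of the partition of a diagram. -/
def IsDiagramBlock (P : Finset (ℕ × ℕ)) (V : Finset (Fin n)) : Prop :=
  (∃ v ∈ P, ∃ a b : Fin n, a.val = v.1 ∧ b.val = v.2 ∧ V = {a, b}) ∨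
    ∃ i : Fin n, i.val ∈ openPoints n P ∧ V = {i}

open Classical in
/-- The partition of a diagram. -/
def partitionOf {E : ℕ → Exponent} {P : Finset (ℕ × ℕ)} (hP : IsDiagram E n P) : SetPartition n :=
  Finpartition.ofExistsUnique (Finset.univ.filter (IsDiagramBlock P))
    (fun _ _ => Finset.subset_univ _)
    (by
      intro i _
      by_cases h : ∃ v ∈ P, i.val = v.1 ∨ i.val = v.2
      · obtain ⟨v, hv, hiv⟩ := h
        have h1 := hP.lt v hv
        have h2 := hP.bound v hv
        refine ⟨{⟨v.1, h1.trans h2⟩, ⟨v.2, h2⟩}, ⟨?_, ?_⟩, ?_⟩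
        · exact Finset.mem_filter.2 ⟨Finset.mem_univ _, Or.inl ⟨v, hv, _, _, rfl, rfl, rfl⟩⟩
        · simpa [Fin.ext_iff] using hiv
        · rintro W ⟨hW, hiW⟩
          rcases (Finset.mem_filter.1 hW).2 with ⟨w, hw, a, b, ha, hb, rfl⟩ | ⟨j, hj, rfl⟩
          · rw [Finset.mem_insert, Finset.mem_singleton, Fin.ext_iff, Fin.ext_iff, ha, hb] at hiW
            have := hP.eq_of_endpoint hv hw hiv hiW
            subst this
            rw [show a = ⟨v.1, h1.trans h2⟩ from Fin.ext ha, show b = ⟨v.2, h2⟩ from Fin.ext hb]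
          · rw [Finset.mem_singleton] at hiW
            subst hiW
            have := (mem_openPoints.1 hj).2 v hv
            exact absurd hiv (by tauto)
      · push Not at h
        refine ⟨{i}, ⟨?_, Finset.mem_singleton_self i⟩, ?_⟩
        · exact Finset.mem_filter.2 ⟨Finset.mem_univ _,
            Or.inr ⟨i, mem_openPoints.2 ⟨i.isLt, h⟩, rfl⟩⟩
        · rintro W ⟨hW, hiW⟩
          rcases (Finset.mem_filter.1 hW).2 with ⟨w, hw, a, b, ha, hb, rfl⟩ | ⟨j, hj, rfl⟩
          · rw [Finset.mem_insert, Finset.mem_singleton, Fin.ext_iff, Fin.ext_iff, ha, hb] at hiW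
            have := h w hw
            exact absurd hiW (by tauto)
          · rw [Finset.mem_singleton.1 hiW])
    (by
      intro h
      rcases (Finset.mem_filter.1 h).2 with ⟨w, hw, a, b, ha, hb, h⟩ | ⟨j, hj, h⟩
      · exact Finset.insert_ne_empty _ _ h.symm
      · exact Finset.singleton_ne_empty _ h.symm)

theorem mem_parts_partitionOf {E : ℕ → Exponent} {P : Finset (ℕ × ℕ)} (hP : IsDiagram E n P)
    {V : Finset (Fin n)} : V ∈ (partitionOf hP).parts ↔ IsDiagramBlock P V := by
  simp [partitionOf, Finpartition.ofExistsUnique]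

theorem lo_hi_of_eq_pair {V : Block π} {a b : Fin n} (hab : a < b) (hV : V.1 = {a, b}) :
    IsPair V ∧ lo V = a ∧ hi V = b := by
  have hp : IsPair V := by rw [IsPair, hV, Finset.card_pair hab.ne]
  have ha : a ∈ V.1 := by rw [hV]; simp
  have hb : b ∈ V.1 := by rw [hV]; simp
  have h1 := lo_mem V
  have h2 := hi_mem V
  rw [hV, Finset.mem_insert, Finset.mem_singleton] at h1 h2
  refine ⟨hp, h1.resolve_right fun h => ?_, h2.resolve_left fun h => ?_⟩
  · exact absurd hab (h ▸ lo_le V ha).not_gt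
  · exact absurd hab (h ▸ le_hi V hb).not_gt

theorem isCompatible_partitionOf {E : ℕ → Exponent} (hE : ∀ i : Fin n, E i = ε i)
    {P : Finset (ℕ × ℕ)} (hP : IsDiagram E n P) : IsCompatible ε (partitionOf hP) := by
  intro V
  rcases (mem_parts_partitionOf hP).1 V.2 with ⟨v, hv, a, b, ha, hb, hV⟩ | ⟨i, hi', hV⟩
  · left
    have hab : a < b := by rw [Fin.lt_def, ha, hb]; exact hP.lt v hv
    obtain ⟨h1, h2, h3⟩ := lo_hi_of_eq_pair hab hV
    rw [h2, h3, ← hE, ← hE, ha, hb]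
    exact ⟨h1, hP.star v hv, hP.one v hv⟩
  · right
    have h1 : IsSingleton V := by rw [IsSingleton, hV, Finset.card_singleton]
    have h2 := lo_mem V
    rw [hV, Finset.mem_singleton] at h2
    rw [h2, ← hE]
    exact ⟨h1, hP.star_of_mem_openPoints hi'⟩

theorem diagram_partitionOf {E : ℕ → Exponent} {P : Finset (ℕ × ℕ)} (hP : IsDiagram E n P) :
    diagram (partitionOf hP) = P := by
  ext v
  rw [mem_diagram]
  constructor
  · rintro ⟨V, hVp, rfl⟩
    rcases (mem_parts_partitionOf hP).1 V.2 with ⟨v, hv, a, b, ha, hb, hV⟩ | ⟨i, hi', hV⟩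
    · have hab : a < b := by rw [Fin.lt_def, ha, hb]; exact hP.lt v hv
      obtain ⟨h1, h2, h3⟩ := lo_hi_of_eq_pair hab hV
      rw [h2, h3, ha, hb]
      exact hv
    · exact absurd (by rw [IsSingleton, hV, Finset.card_singleton]) hVp.not_isSingleton
  · intro hv
    have h1 := hP.lt v hv
    have h2 := hP.bound v hv
    let a : Fin n := ⟨v.1, h1.trans h2⟩
    let b : Fin n := ⟨v.2, h2⟩
    let V : Block (partitionOf hP) := ⟨{a, b}, (mem_parts_partitionOf hP).2
      (Or.inl ⟨v, hv, a, b, rfl, rfl, rfl⟩)⟩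
    have hab : a < b := h1
    obtain ⟨h3, h4, h5⟩ := lo_hi_of_eq_pair (V := V) hab rfl
    exact ⟨V, h3, by rw [h4, h5]⟩

/-- Compatible partitions are the same as diagrams. -/
theorem sum_partitions_eq_sum_diagrams {M : Type*} [AddCommMonoid M] {E : ℕ → Exponent}
    (hE : ∀ i : Fin n, E i = ε i) (F : SetPartition n → M) (G : Finset (ℕ × ℕ) → M)
    (hFG : ∀ π, IsCompatible ε π → F π = G (diagram π)) :
    ∑ π ∈ partitions ε, F π = ∑ P ∈ diagrams E n, G P := by
  refine Finset.sum_bij (fun π _ => diagram π) ?_ ?_ ?_ ?_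
  · intro π hπ
    exact mem_diagrams.2 (isDiagram_diagram (mem_partitions.1 hπ) hE)
  · intro π hπ π' hπ' h
    rw [mem_partitions] at hπ hπ'
    exact Finpartition.ext ((parts_subset_of_diagram_eq hπ hπ' h).antisymm
      (parts_subset_of_diagram_eq hπ' hπ h.symm))
  · intro P hP
    rw [mem_diagrams] at hP
    exact ⟨partitionOf hP, mem_partitions.2 (isCompatible_partitionOf hE hP),
      diagram_partitionOf hP⟩
  · intro π hπ
    exact hFG π (mem_partitions.1 hπ)

/-! ### The statistics of a partition and of its diagram -/

theorem IsCompatible.covers_iff (h : IsCompatible ε π) {V W : Block π} :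
    Covers W V ↔ IsPair W ∧ lo W < lo V ∧ hi V < hi W := by
  constructor
  · rintro ⟨i, hi', j, hj, hk⟩
    have h1 := hk _ (lo_mem V)
    obtain ⟨hp, rfl, rfl⟩ := h.isPair_of_ne hi' hj (h1.1.trans h1.2)
    exact ⟨hp, h1.1, (hk _ (hi_mem V)).2⟩
  · rintro ⟨-, h1, h2⟩
    exact ⟨lo W, lo_mem W, hi W, hi_mem W, fun k hk =>
      ⟨h1.trans_le (lo_le V hk), (le_hi V hk).trans_lt h2⟩⟩

theorem IsCompatible.cross_iff (h : IsCompatible ε π) {V W : Block π} :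
    (∃ i ∈ V.1, ∃ j ∈ V.1, ∃ k ∈ W.1, ∃ l ∈ W.1, i < k ∧ k < j ∧ j < l) ↔
      IsPair V ∧ IsPair W ∧ lo V < lo W ∧ lo W < hi V ∧ hi V < hi W := by
  constructor
  · rintro ⟨i, hi', j, hj, k, hk, l, hl, h1, h2, h3⟩
    obtain ⟨hp, rfl, rfl⟩ := h.isPair_of_ne hi' hj (h1.trans h2)
    obtain ⟨hp', rfl, rfl⟩ := h.isPair_of_ne hk hl (h2.trans h3)
    exact ⟨hp, hp', h1, h2, h3⟩
  · rintro ⟨-, -, h1, h2, h3⟩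
    exact ⟨lo V, lo_mem V, hi V, hi_mem V, lo W, lo_mem W, hi W, hi_mem W, h1, h2, h3⟩

theorem leftOf_iff {V W : Block π} : LeftOf V W ↔ hi V < lo W :=
  ⟨fun h => h _ (hi_mem V) _ (lo_mem W), fun h _ hi' _ hj =>
    (le_hi V hi').trans_lt (h.trans_le (lo_le W hj))⟩

theorem coverCount_eq (h : IsCompatible ε π) (V : Block π) :
    coverCount V = diagramCover (diagram π) (endpoints π V) := by
  classical
  rw [diagramCover, diagram, Finset.sum_map, ← Finset.card_filter, coverCount]
  congr 1
  ext W
  rw [Finset.mem_filter, Finset.mem_filter, mem_pairs, h.covers_iff]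
  simp only [Finset.mem_univ, true_and]
  rfl

theorem singletonsLeft_eq (h : IsCompatible ε π) (V : Block π) :
    singletonsLeft V = diagramLeft n (diagram π) (endpoints π V) := by
  classical
  rw [diagramLeft, openPoints_diagram h, Finset.sum_map, ← Finset.card_filter, singletonsLeft]
  congr 1
  ext W
  rw [Finset.mem_filter, Finset.mem_filter, mem_singletonBlocks, leftOf_iff]
  simp only [Finset.mem_univ, true_and]
  refine and_congr_right fun hW => ?_
  rw [hW.hi_eq]
  rfl

theorem innerSingletons_eq (h : IsCompatible ε π) :
    innerSingletons π = diagramInner n (diagram π) := by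
  classical
  rw [diagramInner, openPoints_diagram h, Finset.sum_map, diagram]
  simp only [Finset.sum_map]
  rw [← Finset.sum_product', ← Finset.card_filter, innerSingletons]
  congr 1
  ext P
  rw [Finset.mem_filter, Finset.mem_filter, Finset.mem_product, mem_singletonBlocks, mem_pairs,
    h.covers_iff]
  simp only [Finset.mem_univ, true_and, and_assoc]
  refine and_congr_right fun hW => ?_
  rw [hW.hi_eq]
  rfl

theorem crossings_eq (h : IsCompatible ε π) : crossings π = diagramCrossings (diagram π) := by
  classical
  rw [diagramCrossings, diagram, Finset.sum_map]
  simp only [Finset.sum_map]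
  rw [← Finset.sum_product', ← Finset.card_filter, crossings]
  symm
  -- The diagram counts a crossing with the pair that opens first in first place; this order makes
  -- the passage to unordered pairs injective.
  refine Finset.card_nbij (fun p => {p.1, p.2}) ?_ ?_ ?_
  · rintro ⟨V, W⟩ hp
    rw [Finset.mem_coe, Finset.mem_filter, Finset.mem_product, mem_pairs, mem_pairs] at hp
    obtain ⟨⟨h1, h2⟩, h3⟩ := hp
    refine Finset.mem_coe.2 <| Finset.mem_filter.2 ⟨Finset.mem_univ _, V, W, ?_, rfl, h.cross_iff.2 ⟨h1, h2, h3⟩⟩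
    rintro rfl
    exact absurd h3.1 (lt_irrefl _)
  · rintro ⟨V, W⟩ hp ⟨V', W'⟩ hp' heq
    have h1 : lo V < lo W := (Finset.mem_filter.1 (Finset.mem_coe.1 hp)).2.1
    have h2 : lo V' < lo W' := (Finset.mem_filter.1 (Finset.mem_coe.1 hp')).2.1
    replace heq : ({V, W} : Finset (Block π)) = {V', W'} := heq
    have hV : V ∈ ({V', W'} : Finset (Block π)) := heq ▸ Finset.mem_insert_self _ _
    have hW : W ∈ ({V', W'} : Finset (Block π)) :=
      heq ▸ Finset.mem_insert_of_mem (Finset.mem_singleton_self _)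
    rw [Finset.mem_insert, Finset.mem_singleton] at hV hW
    rcases hV with rfl | rfl <;> rcases hW with rfl | rfl
    · exact absurd h1 (lt_irrefl _)
    · rfl
    · exact absurd h1 h2.not_gt
    · exact absurd h1 (lt_irrefl _)
  · rintro S hS
    obtain ⟨-, V, W, -, rfl, hc⟩ := Finset.mem_filter.1 (Finset.mem_coe.1 hS)
    obtain ⟨h1, h2, h3⟩ := h.cross_iff.1 hc
    exact ⟨(V, W), Finset.mem_coe.2 (Finset.mem_filter.2
      ⟨Finset.mem_product.2 ⟨mem_pairs.2 h1, mem_pairs.2 h2⟩, h3⟩), rfl⟩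

/-! ### The sum over the colourings -/

theorem innerNegativeBlocks_eq (p : SetPartitionB n) : innerNegativeBlocks p =
    ∑ V ∈ pairs p.1 with p.2 V = -1, coverCount V := by
  classical
  simp only [coverCount, Finset.card_filter]
  rw [innerNegativeBlocks, Finset.card_filter, Fintype.sum_prod_type, Finset.sum_filter, pairs,
    Finset.sum_filter]
  refine Finset.sum_congr rfl fun V _ => ?_
  by_cases h1 : IsPair V <;> by_cases h2 : p.2 V = -1 <;> simp [h1, h2]

theorem singletonsLeftNegative_eq (p : SetPartitionB n) : singletonsLeftNegative p =
    ∑ V ∈ pairs p.1 with p.2 V = -1, singletonsLeft V := by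
  classical
  simp only [singletonsLeft, Finset.card_filter]
  rw [singletonsLeftNegative, Finset.card_filter, Fintype.sum_prod_type_right, Finset.sum_filter,
    pairs, Finset.sum_filter]
  refine Finset.sum_congr rfl fun V _ => ?_
  by_cases h1 : IsPair V <;> by_cases h2 : p.2 V = -1 <;> simp [h1, h2]

theorem negativeBlocks_eq {p : SetPartitionB n} (h : IsCompatible ε p.1)
    (hs : ∀ V, IsSingleton V → p.2 V = 1) :
    negativeBlocks p = Finset.card {V ∈ pairs p.1 | p.2 V = -1} := by
  rw [negativeBlocks]
  congr 1
  ext V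
  rw [Finset.mem_filter, Finset.mem_filter, mem_pairs]
  simp only [Finset.mem_univ, true_and, iff_and_self]
  intro hV
  refine (h.isPair_or V).resolve_right fun h' => ?_
  rw [hs V h'] at hV
  exact absurd hV (by decide)

/-- A product over the pairs of sums of two terms is a sum over the colourings. -/
theorem prod_pairs_add (π : SetPartition n) (h : ∀ V : Block π, IsPair V ∨ IsSingleton V)
    (a b : Block π → ℂ) :
    ∏ V ∈ pairs π, (a V + b V) =
      ∑ f : Block π → ℤˣ, (open Classical in if ∀ V, IsSingleton V → f V = 1 then
        (∏ V ∈ pairs π with f V = 1, a V) * ∏ V ∈ pairs π with f V = -1, b V else 0) := by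
  classical
  -- For a singleton the weights are 1 for the colour 1 and 0 for the colour -1. The product can
  -- then run over all blocks, and the colourings with a negative singleton drop out.
  let c : Block π → ℤˣ → ℂ := fun V s =>
    if IsPair V then (if s = 1 then a V else b V) else if s = 1 then 1 else 0
  have hne : (-1 : ℤˣ) ≠ 1 := by decide
  have h1 : ∏ V ∈ pairs π, (a V + b V) = ∏ V, ∑ s, c V s := by
    rw [pairs, Finset.prod_filter]
    refine Finset.prod_congr rfl fun V _ => ?_
    rw [sum_units]
    by_cases hV : IsPair V <;> simp [c, hV, hne]
  rw [h1, Fintype.prod_sum]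
  refine Finset.sum_congr rfl fun f _ => ?_
  split_ifs with hf
  · rw [Finset.prod_filter, Finset.prod_filter, ← Finset.prod_mul_distrib, pairs,
      Finset.prod_filter]
    refine Finset.prod_congr rfl fun V _ => ?_
    by_cases hV : IsPair V
    · rcases Int.units_eq_one_or (f V) with h2 | h2 <;> simp [c, hV, h2, hne, hne.symm]
    · simp [c, hV, hf V ((h V).resolve_left hV)]
  · push Not at hf
    obtain ⟨V, hV, hfV⟩ := hf
    refine Finset.prod_eq_zero (Finset.mem_univ V) ?_
    have : ¬IsPair V := fun hp => hp.not_isSingleton hV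
    simp [c, this, hfV]

theorem sum_partitionsB {M : Type*} [AddCommMonoid M] (ε : Fin n → Exponent)
    (F : SetPartitionB n → M) :
    ∑ p ∈ partitionsB ε, F p = ∑ π ∈ partitions ε, ∑ f : Block π → ℤˣ,
      (open Classical in if ∀ V : Block π, IsSingleton V → f V = 1 then F ⟨π, f⟩ else 0) := by
  classical
  simp only [← Finset.sum_filter]
  rw [Finset.sum_sigma']
  refine Finset.sum_congr ?_ fun _ _ => rfl
  ext p
  simp [partitionsB, partitions]

end Partitions

/-! ### The Wick formula -/

section WickFormula

variable {H : Type*} [NormedAddCommGroup H] [InnerProductSpace ℂ H] {n : ℕ}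

theorem tensorOn_map_val (X : ℕ → H) (S : Finset (Fin n)) :
    tensorOn X (S.map Fin.valEmbedding) = tensorOver (fun i : Fin n => X i) S := by
  have h : (S.map Fin.valEmbedding).card = S.card := Finset.card_map _
  rw [tensorOn_eq X h, tensorOver]
  have := Finset.orderEmbOfFin_unique h (f := fun k => (S.orderEmbOfFin rfl k).val)
    (fun k => Finset.mem_map_of_mem Fin.valEmbedding (S.orderEmbOfFin_mem rfl k))
    (fun i j hij => by simpa using hij)
  rw [← this]

theorem diagramWeight_diagram (J : H →ₗ[ℂ] H) (α q : ℝ) (X : ℕ → H) {ε : Fin n → Exponent}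
    {π : SetPartition n} (h : IsCompatible ε π) :
    diagramWeight J α q X n (diagram π) =
      (q : ℂ) ^ (crossings π + innerSingletons π) *
        ∏ V ∈ pairs π, (⟪X (hi V), X (lo V)⟫_ℂ +
          (α : ℂ) * (q : ℂ) ^ (2 * coverCount V + 2 * singletonsLeft V) *
            ⟪X (hi V), J (X (lo V))⟫_ℂ) := by
  rw [diagramWeight, ← crossings_eq h, ← innerSingletons_eq h]
  congr 1
  conv_lhs => rw [diagram, Finset.prod_map]
  refine Finset.prod_congr rfl fun V _ => ?_
  rw [coverCount_eq h, singletonsLeft_eq h]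
  rfl

/-- The Wick formula of type B as a sum over the partitions in pairs and singletons. -/
theorem fockWord_vacuum_eq_sum_partitions {J : H →ₗ[ℂ] H} (hJ : Function.Involutive J) {α q : ℝ}
    (hα : α ∈ Set.Ioo (-1 : ℝ) 1) (hq : q ∈ Set.Ioo (-1 : ℝ) 1) (x : Fin n → H)
    (ε : Fin n → Exponent) : fockWord J α q ε x vacuum =
      ∑ π ∈ partitions ε,
        ((q : ℂ) ^ (crossings π + innerSingletons π) *
          ∏ V ∈ pairs π, (⟪x (hi V), x (lo V)⟫_ℂ +
            (α : ℂ) * (q : ℂ) ^ (2 * coverCount V + 2 * singletonsLeft V) *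
              ⟪x (hi V), J (x (lo V))⟫_ℂ)) •
        tensorOver x (singletons π) := by
  -- Letters and vectors are extended to all natural numbers, as the induction on `n` requires. The
  -- default values are arbitrary: only indices below `n` occur.
  obtain ⟨E, rfl⟩ : ∃ E : ℕ → Exponent, (fun i : Fin n => E i) = ε :=
    ⟨fun i => if h : i < n then ε ⟨i, h⟩ else .star, by ext1 i; simp⟩
  obtain ⟨X, rfl⟩ : ∃ X : ℕ → H, (fun i : Fin n => X i) = x :=
    ⟨fun i => if h : i < n then x ⟨i, h⟩ else 0, by ext1 i; simp⟩
  rw [fockWord_vacuum_eq_sum_diagrams hJ hα hq]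
  symm
  refine sum_partitions_eq_sum_diagrams (fun _ => rfl) _ _ fun π h => ?_
  rw [diagramWeight_diagram J α q X h, openPoints_diagram h, ← singletons_eq_image,
    tensorOn_map_val]

/-- In the expanded product each negative pair brings `α q^(2 Cov + 2 SL)`. Summed over the negative
pairs, the exponents are `NB` for `α` and `2 InNB + 2 SLNB` for `q`. -/
theorem sum_colourings (J : H →ₗ[ℂ] H) (α q : ℝ) (x : Fin n → H) {ε : Fin n → Exponent}
    {π : SetPartition n} (h : IsCompatible ε π) (t : Fock H) :
    ∑ f : Block π → ℤˣ, (open Classical in if ∀ V : Block π, IsSingleton V → f V = 1 then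
      ((α : ℂ) ^ negativeBlocks ⟨π, f⟩ *
        (q : ℂ) ^ (crossings π + innerSingletons π + 2 * innerNegativeBlocks ⟨π, f⟩ +
          2 * singletonsLeftNegative ⟨π, f⟩) *
        (∏ V ∈ pairs π with f V = 1, ⟪x (hi V), x (lo V)⟫_ℂ) *
        (∏ V ∈ pairs π with f V = -1, ⟪x (hi V), J (x (lo V))⟫_ℂ)) • t else 0) =
    ((q : ℂ) ^ (crossings π + innerSingletons π) *
      ∏ V ∈ pairs π, (⟪x (hi V), x (lo V)⟫_ℂ +
        (α : ℂ) * (q : ℂ) ^ (2 * coverCount V + 2 * singletonsLeft V) *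
          ⟪x (hi V), J (x (lo V))⟫_ℂ)) • t := by
  rw [prod_pairs_add π h.isPair_or, Finset.mul_sum, Finset.sum_smul]
  refine Finset.sum_congr rfl fun f _ => ?_
  split_ifs with hf
  · rw [negativeBlocks_eq (p := ⟨π, f⟩) h hf, innerNegativeBlocks_eq, singletonsLeftNegative_eq]
    congr 1
    simp only [Finset.prod_mul_distrib, Finset.prod_const, Finset.prod_pow_eq_pow_sum,
      ← Finset.mul_sum, pow_add]
    ring
  · rw [mul_zero, zero_smul]

/-- The Wick formula of type B as a sum over the coloured partitions. -/
theorem fockWord_vacuum_eq_sum_partitionsB {J : H →ₗ[ℂ] H} (hJ : Function.Involutive J)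
    {α q : ℝ} (hα : α ∈ Set.Ioo (-1 : ℝ) 1) (hq : q ∈ Set.Ioo (-1 : ℝ) 1) (x : Fin n → H)
    (ε : Fin n → Exponent) : fockWord J α q ε x vacuum =
      ∑ p ∈ partitionsB ε,
        ((α : ℂ) ^ negativeBlocks p *
          (q : ℂ) ^ (crossings p.1 + innerSingletons p.1 + 2 * innerNegativeBlocks p +
            2 * singletonsLeftNegative p) *
          (∏ V ∈ pairs p.1 with p.2 V = 1, ⟪x (hi V), x (lo V)⟫_ℂ) *
          (∏ V ∈ pairs p.1 with p.2 V = -1, ⟪x (hi V), J (x (lo V))⟫_ℂ)) •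
        tensorOver x (singletons p.1) := by
  rw [fockWord_vacuum_eq_sum_partitions hJ hα hq, sum_partitionsB]
  exact Finset.sum_congr rfl fun π hπ => (sum_colourings J α q x (mem_partitions.1 hπ) _).symm

end WickFormula

theorem inner_ofReal_comm {V : Type*} [NormedAddCommGroup V] [InnerProductSpace ℝ V]
    {z w : Complexification V} (hz : z ∈ Set.range (Complexification.ofReal (V := V)))
    (hw : w ∈ Set.range (Complexification.ofReal (V := V))) : ⟪z, w⟫_ℂ = ⟪w, z⟫_ℂ := by
  obtain ⟨a, rfl⟩ := hz
  obtain ⟨b, rfl⟩ := hw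
  simp [Complexification.inner_def, Complexification.ofReal, real_inner_comm]

end TypeBFock

end

open TypeBFock in
theorem mainTheorem6 {HR : Type*} [NormedAddCommGroup HR] [InnerProductSpace ℝ HR]
    [CompleteSpace HR] [TopologicalSpace.SeparableSpace HR]
    (J : Complexification HR →ₗ[ℂ] Complexification HR)
    (hJ : Function.Involutive J) (hJsa : J.IsSymmetric)
    (α q : ℝ) (hα : α ∈ Set.Ioo (-1 : ℝ) 1) (hq : q ∈ Set.Ioo (-1 : ℝ) 1)
    (n : ℕ) (x : Fin n → Complexification HR)
    (hx : ∀ i, x i ∈ Set.range (Complexification.ofReal (V := HR)))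
    (ε : Fin n → Exponent) :
    -- the annihilation operator is the unique adjoint of the creation operator
    (∀ (y : Complexification HR) (T : Module.End ℂ (Fock (Complexification HR))),
      IsCreationAdjoint J α q y T ↔ T = annihilation J α q y) ∧
    -- the formula over coloured partitions
    fockWord J α q ε x vacuum =
      ∑ p ∈ partitionsB ε,
        ((α : ℂ) ^ negativeBlocks p *
          (q : ℂ) ^ (crossings p.1 + innerSingletons p.1 + 2 * innerNegativeBlocks p +
            2 * singletonsLeftNegative p) *
          (∏ V ∈ pairs p.1 with p.2 V = 1, ⟪x (hi V), x (lo V)⟫_ℂ) *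
          (∏ V ∈ pairs p.1 with p.2 V = -1, ⟪x (hi V), J (x (lo V))⟫_ℂ)) •
        tensorOver x (singletons p.1) ∧
    -- the formula over uncoloured partitions
    fockWord J α q ε x vacuum =
      ∑ π ∈ partitions ε,
        ((q : ℂ) ^ (crossings π + innerSingletons π) *
          ∏ V ∈ pairs π, (⟪x (hi V), x (lo V)⟫_ℂ +
            (α : ℂ) * (q : ℂ) ^ (2 * coverCount V + 2 * singletonsLeft V) *
              ⟪x (hi V), J (x (lo V))⟫_ℂ)) •
        tensorOver x (singletons π) ∧
    -- the order of the two elements of a pair is immaterial when `J` preserves the real space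
    (∀ i j, ⟪x i, x j⟫_ℂ = ⟪x j, x i⟫_ℂ) ∧
    (Set.MapsTo J (Set.range (Complexification.ofReal (V := HR)))
        (Set.range (Complexification.ofReal (V := HR))) →
      ∀ i j, ⟪x i, J (x j)⟫_ℂ = ⟪x j, J (x i)⟫_ℂ) :=
  ⟨isCreationAdjoint_iff hJ hα hq, fockWord_vacuum_eq_sum_partitionsB hJ hα hq x ε,
    fockWord_vacuum_eq_sum_partitions hJ hα hq x ε, fun i j => inner_ofReal_comm (hx i) (hx j),
    -- Since `J (x j)` is real, `⟨x i, J (x j)⟩ = ⟨J (x j), x i⟩`, and self-adjointness moves `J` to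
    -- the other side.
    fun hmaps i j => (inner_ofReal_comm (hx i) (hmaps (hx j))).trans (hJsa (x j) (x i))⟩
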